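/- Let $G$ be a finite connected graph without asteroidal triples (an asteroidal triple is an independent set of three vertices every two of which are joined by a path avoiding the closed neighbourhood of the third), let $c$ be a proper vertex colouring of $G$, and let $x_0$ be an extreme of $G$, i.e. a vertex such that the largest component of $G-N[x_0]$ has maximal cardinality among the largest components of $G-N[v]$, $v\in V(G)$. (In particular, $x_0$ may be a global extreme.) In solitaire Flood-It with source $x_0$, the territory is the set of vertices reachable from $x_0$ by a monochromatic path of the current colour of $x_0$; a move calls a colour $i$ and recolours the whole territory with $i$; the goal is to make the territory equal to $V(G)$ in as few moves as possible. (1) There is a polynomial-time algorithm which, given such $G$, $c$ and $x_0$, computes the minimal number $m$ of moves: one fixed program for a random access machine (with addition, truncated subtraction, comparison and indirect addressing at unit cost) halts with output $m$ after a number of steps bounded by a polynomial in $|V(G)|$. (2) Call a vertex $v$ a maximum of its colour class if, whatever sequence of colours has been called, the whole colour class of $v$ lies in the territory as soon as $v$ does. Give the maxima of colour classes weight $0$ and all other vertices weight $1$; the cost of a path is the sum of the weights of its vertices, endpoints included. Let $x$ be any vertex for which the component $D$ of $G-N[x]$ containing $x_0$ is as large as possible ($D=\emptyset$ if $x_0\in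 N[x]$ for every $x$), let $\Omega=V(G)\setminus(D\cup N(D))$, where $N(D)$ is the set of vertices outside $D$ with a neighbour in $D$, and let $\Omega^*$ be the set of maxima of colour classes that lie in $\Omega$. If $k$ is the number of colours occurring in $c$ and $\mathrm{Opt}$ is the cost of a cheapest path from $x_0$ to a vertex of $\Omega^*$ (such a path exists), then $$m=\mathrm{Opt}+k-1 .$$ (Equivalently, $\mathrm{Opt}+k$ is the minimal length of the colour sequence when the initial colour of the source is counted as its first entry.) -/

import Mathlib

/-! ## AT-free graphs, blocks and extremes -/

namespace FloodIt

section Graphs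

variable {V : Type*} (G : SimpleGraph V)

/-- The closed neighbourhood `N[x]`. -/
def closedNbhd (x : V) : Set V := {v | v = x ∨ G.Adj x v}

/-- `u` and `v` are joined by a path of `G` all of whose vertices (endpoints included) lie
outside `N[x]`. -/
def JoinedAvoiding (x u v : V) : Prop :=
  ∃ p : G.Walk u v, ∀ w ∈ p.support, w ∉ closedNbhd G x

/-- An asteroidal triple: three pairwise distinct, pairwise nonadjacent vertices such that every
two of them are joined by a path avoiding the closed neighbourhood of the third. -/
def IsAsteroidalTriple (x y z : V) : Prop :=
  (x ≠ y ∧ y ≠ z ∧ x ≠ z) ∧ (¬ G.Adj x y ∧ ¬ G.Adj y z ∧ ¬ G.Adj x z) ∧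
    JoinedAvoiding G z x y ∧ JoinedAvoiding G x y z ∧ JoinedAvoiding G y x z

/-- A graph without asteroidal triples. -/
def ATFree : Prop := ∀ x y z : V, ¬ IsAsteroidalTriple G x y z

/-- The vertex set of the component of `G - N[x]` that contains `v`; it is empty if `v ∈ N[x]`. -/
def block (x v : V) : Set V := {u | JoinedAvoiding G x v u}

/-- The number of vertices of a largest component of `G - N[x]`, and `0` if `N[x] = V`. -/
noncomputable def largestBlock [Fintype V] (x : V) : ℕ :=
  Finset.univ.sup fun v => (block G x v).ncard

/-- An extreme of a connected graph: a vertex `x` such that the largest component of `G - N[x]`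
has maximal cardinality among all vertices. -/
def IsExtreme [Fintype V] (x : V) : Prop := ∀ y : V, largestBlock G y ≤ largestBlock G x

/-- `N(D)`: the vertices outside `D` that have a neighbour in `D`. -/
def outerBoundary (D : Set V) : Set V := {v | v ∉ D ∧ ∃ u ∈ D, G.Adj u v}

end Graphs

/-! ## The solitaire game -/

section Game

variable {V C : Type*} (G : SimpleGraph V)

/-- The territory of `x₀` in a colouring `c`: the vertices reachable from `x₀` by a monochromatic
path of colour `c x₀`. -/
def territory (x₀ : V) (c : V → C) : Set V :=
  {v | ∃ p : G.Walk x₀ v, ∀ u ∈ p.support, c u = c x₀}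

open Classical in
/-- Calling the colour `i` recolours the whole territory of `x₀` with `i`. -/
noncomputable def call (x₀ : V) (c : V → C) (i : C) : V → C :=
  fun v => if v ∈ territory G x₀ c then i else c v

/-- The colouring after the colours in the list have been called, from left to right. -/
noncomputable def play (x₀ : V) (c : V → C) (l : List C) : V → C :=
  l.foldl (call G x₀) c

/-- The colour sequence `l` brings all vertices into the territory of `x₀`. -/
def Wins (x₀ : V) (c : V → C) (l : List C) : Prop :=
  territory G x₀ (play G x₀ c l) = Set.univ

/-- `m` is the minimal number of moves in which the game can be won. -/
def IsOptimum (x₀ : V) (c : V → C) (m : ℕ) : Prop :=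
  IsLeast {m : ℕ | ∃ l : List C, l.length = m ∧ Wins G x₀ c l} m

/-- Conquering `x` simultaneously conquers `y`: whatever has been played, if `x` is in the
territory then so is `y`. -/
def Conquers (x₀ : V) (c : V → C) (x y : V) : Prop :=
  ∀ l : List C, x ∈ territory G x₀ (play G x₀ c l) → y ∈ territory G x₀ (play G x₀ c l)

/-- `x` is a maximum of its colour class: conquering `x` simultaneously conquers every vertex of
the same colour. -/
def IsClassMax (x₀ : V) (c : V → C) (x : V) : Prop :=
  ∀ y : V, c y = c x → Conquers G x₀ c x y

open Classical in
/-- Maxima of colour classes have weight `0`, all other vertices weight `1`. -/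
noncomputable def weight (x₀ : V) (c : V → C) (v : V) : ℕ :=
  if IsClassMax G x₀ c v then 0 else 1

/-- The sum of the weights of the vertices of a walk, both endpoints included. -/
noncomputable def cost (x₀ : V) (c : V → C) {u v : V} (p : G.Walk u v) : ℕ :=
  (p.support.map (weight G x₀ c)).sum

/-- `x` maximizes the size of the component of `G - N[x]` that contains the source. -/
def IsFarthest (x₀ x : V) : Prop :=
  ∀ y : V, (block G y x₀).ncard ≤ (block G x x₀).ncard

/-- The far set `Ω = V \ (D ∪ N(D))`, where `D` is the component of `G - N[x]` that contains the
source `x₀`. -/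
def farSet (x₀ x : V) : Set V :=
  {v | v ∉ block G x x₀ ∧ v ∉ outerBoundary G (block G x x₀)}

/-- `Ω*`: the maxima of colour classes that lie in `Ω`. -/
def farMaxima (x₀ : V) (c : V → C) (x : V) : Set V :=
  {v | v ∈ farSet G x₀ x ∧ IsClassMax G x₀ c v}

/-- `w` is the cost of a cheapest path from `x₀` to a vertex of `S`. -/
def IsCheapest (x₀ : V) (c : V → C) (S : Set V) (w : ℕ) : Prop :=
  IsLeast {w : ℕ | ∃ v ∈ S, ∃ p : G.Walk x₀ v, p.IsPath ∧ cost G x₀ c p = w} w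

end Game

/-! ## Random access machines

Structured programs over finitely many registers and arrays of natural numbers, with indirect
addressing of the arrays. The only arithmetic is addition and truncated subtraction, so numbers
grow by at most one bit per step, and unit cost is polynomially equivalent to bit cost. -/

/-- Expressions; registers, arrays and constants are named by numbers fixed in the program. -/
inductive Expr where
  | lit (n : ℕ)
  | reg (r : ℕ)
  | get (a : ℕ) (i : Expr)
  | add (e₁ e₂ : Expr)
  | sub (e₁ e₂ : Expr)

/-- A machine state: the contents of the registers, and of the cells of the arrays. -/
structure State where
  reg : ℕ → ℕ
  arr : ℕ → ℕ → ℕ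

/-- The value of an expression. -/
def Expr.eval (s : State) : Expr → ℕ
  | .lit n => n
  | .reg r => s.reg r
  | .get a i => s.arr a (i.eval s)
  | .add e₁ e₂ => e₁.eval s + e₂.eval s
  | .sub e₁ e₂ => e₁.eval s - e₂.eval s

/-- The number of elementary steps that evaluating an expression takes. -/
def Expr.steps : Expr → ℕ
  | .lit _ => 1
  | .reg _ => 1
  | .get _ i => i.steps + 1
  | .add e₁ e₂ => e₁.steps + e₂.steps + 1
  | .sub e₁ e₂ => e₁.steps + e₂.steps + 1

/-- Write a value into a register. -/
def State.setReg (s : State) (r v : ℕ) : State :=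
  { s with reg := Function.update s.reg r v }

/-- Write a value into a cell of an array. -/
def State.setArr (s : State) (a i v : ℕ) : State :=
  { s with arr := Function.update s.arr a (Function.update (s.arr a) i v) }

/-- Programs; the condition of a branch or a loop is `e₁ < e₂`. -/
inductive Prog where
  | set (r : ℕ) (e : Expr)
  | put (a : ℕ) (i e : Expr)
  | seq (P Q : Prog)
  | ifLt (e₁ e₂ : Expr) (P Q : Prog)
  | whileLt (e₁ e₂ : Expr) (P : Prog)

/-- `Exec P s t s'`: started in the state `s`, the program `P` halts after exactly `t` elementary
steps in the state `s'`. -/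
inductive Exec : Prog → State → ℕ → State → Prop where
  | set (r : ℕ) (e : Expr) (s : State) :
      Exec (.set r e) s (e.steps + 1) (s.setReg r (e.eval s))
  | put (a : ℕ) (i e : Expr) (s : State) :
      Exec (.put a i e) s (i.steps + e.steps + 1) (s.setArr a (i.eval s) (e.eval s))
  | seq (P Q : Prog) (s s₁ s₂ : State) (t₁ t₂ : ℕ) :
      Exec P s t₁ s₁ → Exec Q s₁ t₂ s₂ → Exec (.seq P Q) s (t₁ + t₂) s₂
  | ifTrue (e₁ e₂ : Expr) (P Q : Prog) (s s₁ : State) (t : ℕ) :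
      e₁.eval s < e₂.eval s → Exec P s t s₁ →
        Exec (.ifLt e₁ e₂ P Q) s (e₁.steps + e₂.steps + 1 + t) s₁
  | ifFalse (e₁ e₂ : Expr) (P Q : Prog) (s s₁ : State) (t : ℕ) :
      ¬ e₁.eval s < e₂.eval s → Exec Q s t s₁ →
        Exec (.ifLt e₁ e₂ P Q) s (e₁.steps + e₂.steps + 1 + t) s₁
  | whileTrue (e₁ e₂ : Expr) (P : Prog) (s s₁ s₂ : State) (t₁ t₂ : ℕ) :
      e₁.eval s < e₂.eval s → Exec P s t₁ s₁ → Exec (.whileLt e₁ e₂ P) s₁ t₂ s₂ →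
        Exec (.whileLt e₁ e₂ P) s (e₁.steps + e₂.steps + 1 + t₁ + t₂) s₂
  | whileFalse (e₁ e₂ : Expr) (P : Prog) (s : State) :
      ¬ e₁.eval s < e₂.eval s →
        Exec (.whileLt e₁ e₂ P) s (e₁.steps + e₂.steps + 1) s

open Classical in
/-- The initial state for a graph on `{0, …, n-1}` with colours in `{0, …, k-1}` and source `x₀`:
registers `0`, `1`, `2` hold `n`, `k`, `x₀`, array `0` holds the adjacency matrix row by row,
array `1` holds the colours of the vertices, and everything else is `0`. -/
noncomputable def input {n k : ℕ} (G : SimpleGraph (Fin n)) (c : Fin n → Fin k) (x₀ : Fin n) :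
    State where
  reg := fun r => if r = 0 then n else if r = 1 then k else if r = 2 then (x₀ : ℕ) else 0
  arr := fun a i =>
    if a = 0 then (if ∃ u v : Fin n, G.Adj u v ∧ i = (u : ℕ) * n + v then 1 else 0)
    else if a = 1 then (if h : i < n then (c ⟨i, h⟩ : ℕ) else 0)
    else 0

end FloodIt

/-! Call a vertex terminal if every walk from `x₀` to it meets every closed neighbourhood. For a
proper colouring, a call adds to the territory exactly its neighbours of the called colour, so the
game is a growth process on vertex sets (`territory_play`).

Upper bound (`exists_wins_of_walk`): conquer a walk to a terminal vertex, then call each colour that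
is not yet complete. One call per colour suffices, because the walk dominates. Each call along the
walk is paid for by a vertex of weight 1 or completes a colour, which is then not called again at
the end.

Lower bound (`exists_cheap_walk`): let `τ` be the time at which a vertex is conquered. By
`exists_good_walk` there is a path to any terminal vertex along which `τ` increases and whose
vertices are either block maxima or not the last of their colour to be conquered. The times of the
vertices of the second kind that are not block maxima and the last times of the colours are distinct
numbers in `{0, …, l.length}`.

The lower bound charges all vertices that are not block maxima, the upper bound only those that are
not class maxima. Since block maxima are class maxima (`BlockMax.isClassMax`), the two bounds meet.
Block maxima can be recognized by graph search, which makes the formula algorithmic.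

The geometry rests on a largest component `C` of `G - N[x₀]` with boundary `S`. Extremality forces
every vertex outside `C ∪ N[x₀]` to be adjacent to all of `S`. Without asteroidal triples, two
vertices that can each be reached from `x₀` avoiding the neighbourhood of the other lie outside `C`,
hence both see all of `S`. This makes the vertices of `Ω` terminal and drives the exchange argument
of `exists_good_walk`. -/

namespace FloodIt

/-! ### Walks that avoid closed neighbourhoods, and boundaries of blocks -/

section GraphLemmas

variable {V : Type*} {G : SimpleGraph V}

theorem self_mem_closedNbhd (x : V) : x ∈ closedNbhd G x := Or.inl rfl

theorem mem_closedNbhd_comm {x y : V} : y ∈ closedNbhd G x ↔ x ∈ closedNbhd G y := by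
  simp only [closedNbhd, Set.mem_ofPred_eq, G.adj_comm x y, eq_comm]

theorem JoinedAvoiding.symm {x u v : V} (h : JoinedAvoiding G x u v) :
    JoinedAvoiding G x v u := by
  obtain ⟨p, hp⟩ := h
  exact ⟨p.reverse, by simpa using hp⟩

theorem JoinedAvoiding.trans {x u v w : V} (h : JoinedAvoiding G x u v)
    (h' : JoinedAvoiding G x v w) : JoinedAvoiding G x u w := by
  obtain ⟨p, hp⟩ := h
  obtain ⟨q, hq⟩ := h'
  refine ⟨p.append q, fun a ha => ?_⟩
  rcases SimpleGraph.Walk.mem_support_append_iff _ _ |>.1 ha with h | h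
  exacts [hp a h, hq a h]

theorem JoinedAvoiding.refl {x u : V} (h : u ∉ closedNbhd G x) : JoinedAvoiding G x u u :=
  ⟨.nil, by simpa using h⟩

theorem JoinedAvoiding.left {x u v : V} (h : JoinedAvoiding G x u v) : u ∉ closedNbhd G x := by
  obtain ⟨p, hp⟩ := h
  exact hp _ p.start_mem_support

theorem JoinedAvoiding.right {x u v : V} (h : JoinedAvoiding G x u v) : v ∉ closedNbhd G x :=
  h.symm.left

theorem JoinedAvoiding.adj {x u v w : V} (h : JoinedAvoiding G x u v) (hvw : G.Adj v w)
    (hw : w ∉ closedNbhd G x) : JoinedAvoiding G x u w :=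
  h.trans ⟨hvw.toWalk, by
    intro a ha
    simp at ha
    rcases ha with rfl | rfl
    exacts [h.right, hw]⟩

/-- A walk that starts in a set and ends outside of it contains a boundary vertex. -/
theorem exists_mem_outerBoundary (D : Set V) {u v : V} (p : G.Walk u v) (hu : u ∈ D)
    (hv : v ∉ D) : ∃ w ∈ p.support, w ∈ outerBoundary G D := by
  induction p with
  | nil => exact absurd hu hv
  | @cons a b d h q ih =>
    by_cases hb : b ∈ D
    · obtain ⟨w, hw, hw'⟩ := ih hb hv
      exact ⟨w, by simp [hw], hw'⟩
    · exact ⟨b, by simp, hb, a, hu, h⟩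

/-- A walk that starts outside a set and avoids its boundary stays outside. -/
theorem notMem_of_avoids_outerBoundary (D : Set V) {u v : V} (p : G.Walk u v) (hu : u ∉ D)
    (hp : ∀ w ∈ p.support, w ∉ outerBoundary G D) : ∀ w ∈ p.support, w ∉ D := by
  induction p with
  | nil => simpa using hu
  | @cons a b d h q ih =>
    have hb : b ∉ D := fun hb => hp a (by simp) ⟨hu, b, hb, h.symm⟩
    intro w hw
    rw [SimpleGraph.Walk.support_cons, List.mem_cons] at hw
    rcases hw with rfl | hw
    · exact hu
    · exact ih hb (fun w hw => hp w (by simp [hw])) w hw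

/-- The walks from `x₀` to a vertex outside `block G y x₀` meet `N[y]`. -/
theorem exists_mem_closedNbhd {x₀ v y : V} (h : v ∉ block G y x₀) (p : G.Walk x₀ v) :
    ∃ w ∈ p.support, w ∈ closedNbhd G y := by
  by_contra! hc
  exact h ⟨p, hc⟩

/-- A block that avoids `N[y]` is contained in the block of `y`. -/
theorem block_subset_block {x y v : V} (h : ∀ w ∈ block G x v, w ∉ closedNbhd G y) :
    block G x v ⊆ block G y v := by
  rintro u ⟨p, hp⟩
  refine ⟨p, fun w hw => h w ?_⟩
  classical
  exact ⟨p.takeUntil w hw, fun a ha => hp a (p.support_takeUntil_subset_support hw ha)⟩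

theorem outerBoundary_block_subset {x v p : V} (hp : p ∈ outerBoundary G (block G x v)) :
    p ∈ closedNbhd G x := by
  obtain ⟨h1, u, hu, hup⟩ := hp
  by_contra hx
  exact h1 (JoinedAvoiding.adj hu hup hx)

theorem closedNbhd_subset_block {x v w : V} (hw : w ∈ block G x v) {a : V}
    (ha : a ∈ closedNbhd G w) : a ∈ block G x v ∨ a ∈ outerBoundary G (block G x v) := by
  rcases ha with rfl | ha
  · exact Or.inl hw
  · by_cases h : a ∈ block G x v
    · exact Or.inl h
    · exact Or.inr ⟨h, w, hw, ha⟩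

/-- All paths from `x₀` to `v` are dominating. -/
def Terminal (G : SimpleGraph V) (x₀ v : V) : Prop := ∀ y, v ∉ block G y x₀

variable {x₀ : V}

theorem adj_of_mem_outerBoundary {u s : V} (hs : s ∈ outerBoundary G (block G x₀ u)) :
    G.Adj x₀ s := by
  rcases outerBoundary_block_subset hs with rfl | h
  · obtain ⟨-, a, ha, has⟩ := hs
    exact absurd (Or.inr has.symm) (JoinedAvoiding.right ha)
  · exact h

theorem ne_of_notMem_closedNbhd {x y : V} (h : y ∉ closedNbhd G x) : x ≠ y ∧ ¬ G.Adj x y :=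
  ⟨fun e => h (Or.inl e.symm), fun e => h (Or.inr e)⟩

theorem notMem_closedNbhd_of_mem_block {y z : V} (h : z ∈ block G y x₀) :
    y ∉ closedNbhd G x₀ := fun h' => JoinedAvoiding.left h (mem_closedNbhd_comm.1 h')

/-- A walk from `x₀` that avoids the boundary of a component `C` of `G - N[x₀]` avoids the
neighbourhoods of the vertices of `C`. -/
theorem mem_block_of_avoids {u w v : V} (hw : w ∈ block G x₀ u) (p : G.Walk x₀ v)
    (hp : ∀ a ∈ p.support, a ∉ outerBoundary G (block G x₀ u)) : v ∈ block G w x₀ := by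
  refine ⟨p, fun a ha h => ?_⟩
  rcases closedNbhd_subset_block hw h with h | h
  · exact notMem_of_avoids_outerBoundary (block G x₀ u) p
      (fun h => JoinedAvoiding.right h (self_mem_closedNbhd x₀)) hp a ha h
  · exact hp a ha h

theorem mem_farSet_self (x₀ x : V) : x ∈ farSet G x₀ x :=
  ⟨fun h => JoinedAvoiding.right h (self_mem_closedNbhd x), fun ⟨_, _, hu, h⟩ =>
    JoinedAvoiding.right hu (Or.inr h.symm)⟩

/-- If `y` and `z` can be reached from `x₀` avoiding each other's neighbourhoods, then they are
in different components of `G - N[x₀]`. -/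
theorem ATFree.not_joined (hG : ATFree G) {y z : V} (hyz : z ∈ block G y x₀)
    (hzy : y ∈ block G z x₀) : ¬ JoinedAvoiding G x₀ y z := by
  intro h
  have h1 := ne_of_notMem_closedNbhd (JoinedAvoiding.left hyz)
  have h2 := ne_of_notMem_closedNbhd (JoinedAvoiding.left hzy)
  have h3 := ne_of_notMem_closedNbhd (JoinedAvoiding.right hyz)
  exact hG x₀ y z ⟨⟨h1.1.symm, h3.1, h2.1.symm⟩, ⟨fun h => h1.2 h.symm, h3.2,
    fun h => h2.2 h.symm⟩, hzy, h, hyz⟩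

/-! ### Extremes, terminal vertices and the exchange argument -/

section Extreme

variable [Fintype V]

theorem ncard_block_le (x v : V) : (block G x v).ncard ≤ largestBlock G x :=
  Finset.le_sup (f := fun v => (block G x v).ncard) (Finset.mem_univ v)

/-- A largest component of `G - N[x₀]`. -/
theorem exists_largest (x₀ : V) : ∃ u, (block G x₀ u).ncard = largestBlock G x₀ := by
  obtain ⟨u, -, hu⟩ := Finset.exists_mem_eq_sup (Finset.univ : Finset V) ⟨x₀, Finset.mem_univ _⟩
    (fun v => (block G x₀ v).ncard)
  exact ⟨u, hu.symm⟩

theorem exists_largest_mem {z : V} (hz : z ∉ closedNbhd G x₀) :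
    ∃ u, u ∈ block G x₀ u ∧ (block G x₀ u).ncard = largestBlock G x₀ := by
  obtain ⟨u, hu⟩ := exists_largest (G := G) x₀
  refine ⟨u, ?_, hu⟩
  have h1 := ncard_block_le (G := G) x₀ z
  have h2 : 0 < (block G x₀ z).ncard :=
    (Set.ncard_pos (Set.toFinite _)).2 ⟨z, JoinedAvoiding.refl hz⟩
  have h3 : (block G x₀ u).Nonempty := (Set.ncard_pos (Set.toFinite _)).1 (by omega)
  obtain ⟨a, ha⟩ := h3
  exact JoinedAvoiding.refl (JoinedAvoiding.left ha)

/-- If `x₀` is an extreme, a vertex of `G - N[x₀]` outside the largest component `C` is adjacent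
to all of `N(C)`. -/
theorem outerBoundary_largest_subset (hx₀ : IsExtreme G x₀) {u z : V}
    (hC : (block G x₀ u).ncard = largestBlock G x₀) (hz : z ∉ closedNbhd G x₀)
    (hzC : z ∉ block G x₀ u) {s : V} (hs : s ∈ outerBoundary G (block G x₀ u)) : G.Adj z s := by
  by_contra hzs
  have hsz : s ∉ closedNbhd G z := by
    rintro (rfl | h)
    · exact hz (outerBoundary_block_subset hs)
    · exact hzs h
  -- `N[z]` misses both `C` and `s`, so `C ∪ {s}` lies in one component of `G - N[z]`, which is too
  -- large for an extreme.
  have hCz : ∀ w ∈ block G x₀ u, w ∉ closedNbhd G z := by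
    rintro w hw h
    rw [mem_closedNbhd_comm] at h
    rcases closedNbhd_subset_block hw h with h | h
    · exact hzC h
    · exact hz (outerBoundary_block_subset h)
  have hsub := block_subset_block hCz
  have hs' : s ∈ block G z u := by
    obtain ⟨-, a, ha, has⟩ := hs
    exact JoinedAvoiding.adj (hsub ha) has hsz
  have hlt : (block G x₀ u).ncard < (block G z u).ncard :=
    Set.ncard_lt_ncard ⟨hsub, fun h => hs.1 (h hs')⟩ (Set.toFinite _)
  have := hx₀ z
  have := ncard_block_le (G := G) z u
  omega

/-- Mutually avoiding vertices: `z` is outside the largest component. -/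
theorem notMem_largest (hG : ATFree G) (hx₀ : IsExtreme G x₀) {u y z : V}
    (hC : (block G x₀ u).ncard = largestBlock G x₀) (hyz : z ∈ block G y x₀)
    (hzy : y ∈ block G z x₀) : z ∉ block G x₀ u := by
  intro hz
  have hy : y ∉ block G x₀ u := fun hy =>
    hG.not_joined hyz hzy ((JoinedAvoiding.symm hy).trans hz)
  obtain ⟨p, hp⟩ := hyz
  -- A walk from `x₀` into `C` crosses the boundary of `C`, all of which lies in `N(y)`; but `p`
  -- avoids `N[y]`.
  refine notMem_of_avoids_outerBoundary (block G x₀ u) p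
    (fun h => JoinedAvoiding.right h (self_mem_closedNbhd x₀)) (fun w hw h => ?_) z
    p.end_mem_support hz
  refine hp w hw (Or.inr (outerBoundary_largest_subset hx₀ hC ?_ hy h))
  exact fun h' => hp _ p.start_mem_support (mem_closedNbhd_comm.1 h')

/-- If `N[y]` could be avoided on the way to `v`, some vertex would have a block around `x₀` that
properly contains `D`, or `v` would lie in `D` itself. The case `y ∈ D` is the one that needs
extremality and the absence of asteroidal triples. -/
theorem terminal_of_mem_farSet (hG : ATFree G) (hx₀ : IsExtreme G x₀) {x v : V}
    (hx : IsFarthest G x₀ x) (hv : v ∈ farSet G x₀ x) : Terminal G x₀ v := by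
  intro y hvy
  have key : ∀ z a, block G x x₀ ⊆ block G z x₀ → a ∈ block G z x₀ → a ∉ block G x x₀ →
      False := fun z a h1 h2 h3 => by
    have := Set.ncard_lt_ncard ⟨h1, fun h => h3 (h h2)⟩ (Set.toFinite _)
    have := hx z
    omega
  have far : ∀ z, z ∉ block G x x₀ → z ∉ outerBoundary G (block G x x₀) →
      block G x x₀ ⊆ block G z x₀ := by
    intro z h1 h2
    refine block_subset_block fun w hw h => ?_
    rcases closedNbhd_subset_block hw (mem_closedNbhd_comm.1 h) with h | h
    exacts [h1 h, h2 h]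
  by_cases hyD : y ∈ block G x x₀
  swap
  · by_cases hyN : y ∈ outerBoundary G (block G x x₀)
    · obtain ⟨-, a, ha, hay⟩ := hyN
      refine key v y (far v hv.1 hv.2) (JoinedAvoiding.adj (far v hv.1 hv.2 ha) hay ?_) hyD
      exact fun h => JoinedAvoiding.right hvy (mem_closedNbhd_comm.1 h)
    · exact key y v (far y hyD hyN) hvy hv.1
  -- The walk to `v` leaves `D` through a neighbour of `x`, so `x` can be reached without touching
  -- `N[y]`. Hence `x` and `y` avoid each other.
  have hxy : x ∈ block G y x₀ := by
    obtain ⟨p, hp⟩ := hvy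
    obtain ⟨q, hq, hqD⟩ := exists_mem_outerBoundary (block G x x₀) p
      (JoinedAvoiding.refl (JoinedAvoiding.left hyD)) hv.1
    classical
    have hj : JoinedAvoiding G y x₀ q :=
      ⟨p.takeUntil q hq, fun a ha => hp a (p.support_takeUntil_subset_support hq ha)⟩
    rcases outerBoundary_block_subset hqD with rfl | h
    · exact hj
    · exact JoinedAvoiding.adj hj h.symm fun h =>
        JoinedAvoiding.right hyD (mem_closedNbhd_comm.1 h)
  obtain ⟨u, hu, hC⟩ := exists_largest_mem (G := G) (x₀ := x₀) (notMem_closedNbhd_of_mem_block hyD)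
  have hyC := notMem_largest hG hx₀ hC hyD hxy
  obtain ⟨p, hp⟩ := hvy
  have hpS : ∀ a ∈ p.support, a ∉ outerBoundary G (block G x₀ u) := fun a ha h =>
    hp a ha (Or.inr (outerBoundary_largest_subset hx₀ hC
      (notMem_closedNbhd_of_mem_block hxy) hyC h))
  -- The walk `p` misses `S ⊆ N(y)`. If `x ∈ C`, then `p` also misses `N[x]` and `v ∈ D`. Otherwise
  -- `S ⊆ N(x)`, so walks within `D` miss `S` too, and the block of `u ∈ C` contains `D` together
  -- with `v`.
  by_cases hxC : x ∈ block G x₀ u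
  · exact hv.1 (mem_block_of_avoids hxC p hpS)
  · refine key u v ?_ (mem_block_of_avoids hu p hpS) hv.1
    rintro a ⟨q, hq⟩
    refine mem_block_of_avoids hu q fun b hb h => hq b hb (Or.inr ?_)
    exact outerBoundary_largest_subset hx₀ hC (notMem_closedNbhd_of_mem_block hyD) hxC h

theorem exists_isFarthest (x₀ : V) : ∃ x, IsFarthest G x₀ x := by
  obtain ⟨x, -, hx⟩ := Finset.exists_max_image (Finset.univ : Finset V)
    (fun y => (block G y x₀).ncard) ⟨x₀, Finset.mem_univ _⟩
  exact ⟨x, fun y => hx y (Finset.mem_univ _)⟩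

theorem exists_terminal (hG : ATFree G) (hx₀ : IsExtreme G x₀) : ∃ v, Terminal G x₀ v := by
  obtain ⟨x, hx⟩ := exists_isFarthest (G := G) x₀
  exact ⟨x, terminal_of_mem_farSet hG hx₀ hx (mem_farSet_self x₀ x)⟩

/-- No vertex of the same colour can be avoided on the way from `x₀` to `v`. -/
def BlockMax {C : Type*} (G : SimpleGraph V) (x₀ : V) (c : V → C) (v : V) : Prop :=
  ∀ y, c y = c v → v ∉ block G y x₀

/-- Let `τ` decrease along some edge at every vertex other than `x₀`. Every terminal vertex is
the end of a walk from `x₀` along which `τ` increases, and whose vertices either are block maxima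
or do not maximize `τ` on their colour class. -/
theorem exists_good_walk {C : Type*} (hG : ATFree G) (hx₀ : IsExtreme G x₀) (c : V → C)
    (τ : V → ℕ) (hτ₀ : ∀ v, τ v = 0 ↔ v = x₀)
    (hτ : ∀ v, v ≠ x₀ → ∃ u, G.Adj u v ∧ τ u < τ v) {v : V} (hv : Terminal G x₀ v) :
    ∃ p : G.Walk x₀ v, (p.support.map τ).Pairwise (· < ·) ∧
      ∀ u ∈ p.support, BlockMax G x₀ c u ∨ ∃ u', c u' = c u ∧ τ u < τ u' := by
  set Good : V → Prop := fun u => BlockMax G x₀ c u ∨ ∃ u', c u' = c u ∧ τ u < τ u' with hGood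
  -- The walk is built backwards from `v`: `q` is the part already built and `z` is a candidate to
  -- be put in front of it. The measure orders candidates lexicographically, by smaller `τ z` and
  -- then by larger block of `z`.
  suffices H : ∀ (N : ℕ) (z u : V) (q : G.Walk u v), G.Adj z u → τ z < τ u →
      (q.support.map τ).Pairwise (· < ·) → (∀ a ∈ q.support, Good a) →
      τ z * (Fintype.card V + 1) + (Fintype.card V - (block G z x₀).ncard) < N →
      ∃ p : G.Walk x₀ v, (p.support.map τ).Pairwise (· < ·) ∧ ∀ a ∈ p.support, Good a by
    have hvg : Good v := Or.inl fun y _ => hv y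
    by_cases hvx : v = x₀
    · subst hvx
      exact ⟨.nil, by simp, by simpa using hvg⟩
    · obtain ⟨u, hu, hlt⟩ := hτ v hvx
      exact H _ u v .nil hu hlt (by simp) (by simpa using hvg) (Nat.lt_succ_self _)
  have tail_le : ∀ {u a : V} (q : G.Walk u v), (q.support.map τ).Pairwise (· < ·) →
      a ∈ q.support → τ u ≤ τ a := by
    intro u a q hq ha
    rw [← SimpleGraph.Walk.cons_tail_support, List.map_cons, List.pairwise_cons] at hq
    rw [← SimpleGraph.Walk.cons_tail_support, List.mem_cons] at ha
    rcases ha with rfl | ha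
    · exact le_rfl
    · exact (hq.1 _ (List.mem_map_of_mem ha)).le
  intro N
  induction N with
  | zero => intro z u q _ _ _ _ h; omega
  | succ N ih =>
    intro z u q hzu hlt hq hqg hN
    -- A bad candidate is replaced by another one, attached to a later vertex of `q`; the vertices
    -- of `q` before it are discarded.
    have drop : ∀ (z' a : V) (_ : a ∈ q.support), G.Adj z' a → τ z' ≤ τ z →
        τ z' * (Fintype.card V + 1) + (Fintype.card V - (block G z' x₀).ncard) <
          τ z * (Fintype.card V + 1) + (Fintype.card V - (block G z x₀).ncard) →
        ∃ p : G.Walk x₀ v, (p.support.map τ).Pairwise (· < ·) ∧ ∀ a ∈ p.support, Good a := by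
      intro z' a ha hza hle hm
      classical
      refine ih z' a (q.dropUntil a ha) hza ?_ ?_ ?_ (by omega)
      · have := tail_le q hq ha
        omega
      · refine hq.sublist (List.Sublist.map τ ?_)
        conv_rhs => rw [← q.take_spec ha,
          SimpleGraph.Walk.support_append_eq_support_dropLast_append]
        exact List.sublist_append_right _ _
      · exact fun b hb => hqg b (q.support_dropUntil_subset_support ha hb)
    have meas : ∀ z', τ z' < τ z →
        τ z' * (Fintype.card V + 1) + (Fintype.card V - (block G z' x₀).ncard) <
          τ z * (Fintype.card V + 1) + (Fintype.card V - (block G z x₀).ncard) := by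
      intro z' h
      have : (τ z' + 1) * (Fintype.card V + 1) ≤ τ z * (Fintype.card V + 1) :=
        Nat.mul_le_mul_right _ h
      rw [Nat.add_mul] at this
      omega
    by_cases hz : Good z
    · have hq' : ((SimpleGraph.Walk.cons hzu q).support.map τ).Pairwise (· < ·) := by
        rw [SimpleGraph.Walk.support_cons, List.map_cons, List.pairwise_cons]
        refine ⟨fun t ht => ?_, hq⟩
        obtain ⟨a, ha, rfl⟩ := List.mem_map.1 ht
        exact hlt.trans_le (tail_le q hq ha)
      have hg' : ∀ a ∈ (SimpleGraph.Walk.cons hzu q).support, Good a := by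
        intro a ha
        rw [SimpleGraph.Walk.support_cons, List.mem_cons] at ha
        rcases ha with rfl | ha
        exacts [hz, hqg a ha]
      by_cases hzx : z = x₀
      · subst hzx
        exact ⟨_, hq', hg'⟩
      · obtain ⟨w, hw, hwlt⟩ := hτ z hzx
        have := meas w hwlt
        exact ih w z _ hw hwlt hq' hg' (by omega)
    · rw [hGood] at hz
      simp only [BlockMax, not_or, not_forall, not_exists, not_and, not_not, not_lt] at hz
      obtain ⟨⟨z', hcz, hzz'⟩, hmax⟩ := hz
      have hz'le := hmax z' hcz
      obtain ⟨Q, hQ⟩ := id hzz'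
      -- The walk `Q` reaches `z` while avoiding `N[z']`. If `z` and `z'` avoid each other, then `S
      -- ⊆ N(z')`, so `Q` misses `S`. Since `v` is terminal, the continued walk must meet `S`,
      -- necessarily on `q`, and there `x₀` itself can be attached.
      by_cases hz'z : z' ∈ block G z x₀
      · obtain ⟨s, hs, hn⟩ := exists_largest_mem (G := G) (x₀ := x₀)
          (notMem_closedNbhd_of_mem_block hz'z)
        have hz'C := notMem_largest hG hx₀ hn hz'z hzz'
        have hmeet : ∃ a ∈ ((Q.append hzu.toWalk).append q).support,
            a ∈ outerBoundary G (block G x₀ s) := by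
          by_contra! hcon
          exact hv s (mem_block_of_avoids hs _ hcon)
        obtain ⟨a, ha, haS⟩ := hmeet
        have haq : a ∈ q.support := by
          have hnQ : a ∉ Q.support := fun h => hQ a h (Or.inr
            (outerBoundary_largest_subset hx₀ hn (notMem_closedNbhd_of_mem_block hzz') hz'C haS))
          simp only [SimpleGraph.Walk.mem_support_append_iff] at ha
          rcases ha with (h | h) | h
          · exact absurd h hnQ
          · simp at h
            rcases h with rfl | rfl
            · exact absurd Q.end_mem_support hnQ
            · exact q.start_mem_support
          · exact h
        have hzne : z ≠ x₀ := fun h => JoinedAvoiding.left hz'z (Or.inl h.symm)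
        have h0 : τ x₀ = 0 := (hτ₀ x₀).2 rfl
        have hzpos : 0 < τ z := Nat.pos_of_ne_zero fun h => hzne ((hτ₀ z).1 h)
        exact drop x₀ a haq (adj_of_mem_outerBoundary haS) (by omega) (meas _ (by omega))
      -- Otherwise `z'` replaces `z`: the continued walk meets `N[z']`, and it can do so only on
      -- `q`.
      · obtain ⟨a, ha, haN⟩ := exists_mem_closedNbhd (hv z') ((Q.append hzu.toWalk).append q)
        have haq : a ∈ q.support := by
          have hnQ : a ∉ Q.support := fun h => hQ a h haN
          simp only [SimpleGraph.Walk.mem_support_append_iff] at ha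
          rcases ha with (h | h) | h
          · exact absurd h hnQ
          · simp at h
            rcases h with rfl | rfl
            · exact absurd Q.end_mem_support hnQ
            · exact q.start_mem_support
          · exact h
        have hza : G.Adj z' a := by
          rcases haN with rfl | h
          · have := tail_le q hq haq
            omega
          · exact h
        refine drop z' a haq hza hz'le ?_
        rcases hz'le.lt_or_eq with hlt' | heq
        · exact meas _ hlt'
        -- If the times tie, the second component of the measure drops: the block of `z'` contains
        -- that of `z`, and also `z`.
        · have hsub : block G z x₀ ⊆ block G z' x₀ := by
            refine block_subset_block fun w hw h => ?_
            rcases h with rfl | h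
            · exact hz'z hw
            · refine hz'z (JoinedAvoiding.adj hw h.symm fun h => ?_)
              exact JoinedAvoiding.right hzz' (mem_closedNbhd_comm.1 h)
          have hlt' : (block G z x₀).ncard < (block G z' x₀).ncard :=
            Set.ncard_lt_ncard ⟨hsub, fun h =>
              JoinedAvoiding.right (h hzz') (self_mem_closedNbhd z)⟩ (Set.toFinite _)
          have hle : (block G z' x₀).ncard ≤ Fintype.card V := by
            rw [← Nat.card_eq_fintype_card]
            exact Set.ncard_le_card _
          rw [heq]
          omega

end Extreme

end GraphLemmas

/-! ### The game as a growth process, and the two bounds -/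

section GameLemmas

variable {V C : Type*} {G : SimpleGraph V} {x₀ : V} {c : V → C}

/-- The vertices added to the territory `T` by calling `i`, together with `T`. -/
def grow (G : SimpleGraph V) (c : V → C) (T : Set V) (i : C) : Set V :=
  T ∪ {v | c v = i ∧ ∃ u ∈ T, G.Adj u v}

/-- The territory after the calls `l`. -/
def conquered (G : SimpleGraph V) (x₀ : V) (c : V → C) (l : List C) : Set V :=
  l.foldl (grow G c) {x₀}

theorem conquered_append_singleton (l : List C) (i : C) :
    conquered G x₀ c (l ++ [i]) = grow G c (conquered G x₀ c l) i := by
  simp [conquered, List.foldl_append]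

theorem conquered_subset_append (l l' : List C) :
    conquered G x₀ c l ⊆ conquered G x₀ c (l ++ l') := by
  induction l' using List.reverseRecOn with
  | nil => simp
  | append_singleton l' i ih =>
    rw [← List.append_assoc, conquered_append_singleton]
    exact ih.trans Set.subset_union_left

theorem source_mem_conquered (l : List C) : x₀ ∈ conquered G x₀ c l :=
  conquered_subset_append [] l rfl

theorem mem_conquered_of_adj {l : List C} {u v : V} (hu : u ∈ conquered G x₀ c l)
    (h : G.Adj u v) : v ∈ conquered G x₀ c (l ++ [c v]) := by
  rw [conquered_append_singleton]
  exact Or.inr ⟨rfl, u, hu, h⟩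

theorem territory_subset {f : V → C} {S : Set V} (h₀ : x₀ ∈ S)
    (hS : ∀ u ∈ S, ∀ v, G.Adj u v → f u = f x₀ → f v = f x₀ → v ∈ S) :
    territory G x₀ f ⊆ S := by
  rintro v ⟨p, hp⟩
  suffices H : ∀ {a b : V} (q : G.Walk a b), a ∈ S → (∀ u ∈ q.support, f u = f x₀) → b ∈ S from
    H p h₀ hp
  intro a b q
  induction q with
  | nil => exact fun h _ => h
  | @cons a b d h q ih =>
    intro ha hq
    exact ih (hS a ha b h (hq a (by simp)) (hq b (by simp))) fun u hu => hq u (by simp [hu])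

theorem source_mem_territory (f : V → C) : x₀ ∈ territory G x₀ f := ⟨.nil, by simp⟩

theorem mem_territory_of_adj {f : V → C} {u v : V} (hu : u ∈ territory G x₀ f)
    (h : G.Adj u v) (hv : f v = f x₀) : v ∈ territory G x₀ f := by
  obtain ⟨p, hp⟩ := hu
  refine ⟨p.concat h, fun w hw => ?_⟩
  rw [SimpleGraph.Walk.support_concat, List.mem_append, List.mem_singleton] at hw
  rcases hw with hw | rfl
  exacts [hp w hw, hv]

/-- Calling a colour adds the neighbours of that colour to the territory. -/
theorem territory_call (hc : ∀ u v, G.Adj u v → c u ≠ c v) {f : V → C}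
    (hf : ∀ v, v ∉ territory G x₀ f → f v = c v) (i : C) :
    territory G x₀ (call G x₀ f i) = grow G c (territory G x₀ f) i := by
  have h1 : ∀ v ∈ territory G x₀ f, call G x₀ f i v = i := fun v hv => by simp [call, hv]
  have h2 : ∀ v, v ∉ territory G x₀ f → call G x₀ f i v = c v := fun v hv => by
    simp [call, hv, hf v hv]
  have h0 := h1 x₀ (source_mem_territory f)
  have h3 : territory G x₀ f ⊆ territory G x₀ (call G x₀ f i) := by
    have : territory G x₀ f ⊆ territory G x₀ f ∩ territory G x₀ (call G x₀ f i) := by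
      refine territory_subset ⟨source_mem_territory f, source_mem_territory _⟩ ?_
      intro u hu v huv _ hv
      have := mem_territory_of_adj hu.1 huv hv
      exact ⟨this, mem_territory_of_adj hu.2 huv ((h1 v this).trans h0.symm)⟩
    exact fun v hv => (this hv).2
  refine Set.Subset.antisymm (territory_subset (Or.inl (source_mem_territory f)) ?_) ?_
  · intro u hu v huv hu' hv'
    rw [h0] at hu' hv'
    by_cases hv : v ∈ territory G x₀ f
    · exact Or.inl hv
    · rw [h2 v hv] at hv'
      refine Or.inr ⟨hv', u, ?_, huv⟩
      rcases hu with hu | ⟨hu, -⟩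
      · exact hu
      · exact absurd (hu.trans hv'.symm) (hc u v huv)
  · rintro v (hv | ⟨hv, u, hu, huv⟩)
    · exact h3 hv
    · by_cases hv' : v ∈ territory G x₀ f
      · exact h3 hv'
      · exact mem_territory_of_adj (h3 hu) huv (by rw [h0, h2 v hv', hv])

/-- The second conjunct is the invariant required by `territory_call`: unconquered vertices keep
their original colours, which form a proper colouring. -/
theorem territory_play (hc : ∀ u v, G.Adj u v → c u ≠ c v) (l : List C) :
    territory G x₀ (play G x₀ c l) = conquered G x₀ c l ∧
      ∀ v, v ∉ territory G x₀ (play G x₀ c l) → play G x₀ c l v = c v := by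
  induction l using List.reverseRecOn with
  | nil =>
    refine ⟨Set.Subset.antisymm (territory_subset rfl ?_) ?_, fun v _ => rfl⟩
    · rintro u rfl v huv - h
      exact absurd h.symm (hc _ _ huv)
    · rintro v rfl
      exact source_mem_territory _
  | append_singleton l i ih =>
    have hplay : play G x₀ c (l ++ [i]) = call G x₀ (play G x₀ c l) i := by
      simp [play, List.foldl_append]
    have ht := territory_call hc ih.2 i
    rw [hplay, conquered_append_singleton, ← ih.1]
    refine ⟨ht, fun v hv => ?_⟩
    have hv' : v ∉ territory G x₀ (play G x₀ c l) := fun h => hv (ht ▸ Or.inl h)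
    simp only [call, hv', if_false]
    exact ih.2 v hv'

theorem wins_iff (hc : ∀ u v, G.Adj u v → c u ≠ c v) (l : List C) :
    Wins G x₀ c l ↔ conquered G x₀ c l = Set.univ := by
  rw [Wins, (territory_play hc l).1]

theorem isClassMax_iff (hc : ∀ u v, G.Adj u v → c u ≠ c v) (v : V) :
    IsClassMax G x₀ c v ↔ ∀ l, v ∈ conquered G x₀ c l → ∀ y, c y = c v →
      y ∈ conquered G x₀ c l := by
  simp only [IsClassMax, Conquers, (territory_play hc _).1]
  exact ⟨fun h l hl y hy => h y hy l hl, fun h y hy l hl => h l hl y hy⟩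

theorem exists_walk_conquered (l : List C) {v : V} (hv : v ∈ conquered G x₀ c l) :
    ∃ p : G.Walk x₀ v, ∀ u ∈ p.support, u ∈ conquered G x₀ c l := by
  induction l using List.reverseRecOn generalizing v with
  | nil =>
    obtain rfl : v = x₀ := hv
    exact ⟨.nil, by simpa using source_mem_conquered []⟩
  | append_singleton l i ih =>
    have hsub := conquered_subset_append (G := G) (x₀ := x₀) (c := c) l [i]
    have hv' := hv
    rw [conquered_append_singleton] at hv'
    rcases hv' with hv' | ⟨-, u, hu, huv⟩
    · obtain ⟨p, hp⟩ := ih hv'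
      exact ⟨p, fun u hu => hsub (hp u hu)⟩
    · obtain ⟨p, hp⟩ := ih hu
      refine ⟨p.concat huv, fun w hw => ?_⟩
      rw [SimpleGraph.Walk.support_concat, List.mem_append, List.mem_singleton] at hw
      rcases hw with hw | rfl
      exacts [hsub (hp w hw), hv]

/-- Just after `v` is conquered there is a walk to `v` inside the territory, and it meets `N[y]`. By
properness it does so at `y` itself or before its last vertex, so the call that conquers `v`
conquers `y` at the latest. -/
theorem BlockMax.isClassMax (hc : ∀ u v, G.Adj u v → c u ≠ c v) {v : V}
    (h : BlockMax G x₀ c v) : IsClassMax G x₀ c v := by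
  rw [isClassMax_iff hc]
  intro l hv y hy
  have hb := h y hy
  induction l using List.reverseRecOn with
  | nil =>
    obtain rfl : v = x₀ := hv
    obtain ⟨w, hw, hwy⟩ := exists_mem_closedNbhd hb (.nil : G.Walk v v)
    simp only [SimpleGraph.Walk.support_nil, List.mem_singleton] at hw
    subst hw
    rcases hwy with rfl | hwy
    · exact source_mem_conquered _
    · exact absurd hy (hc _ _ hwy)
  | append_singleton l i ih =>
    have hv' := hv
    rw [conquered_append_singleton] at hv'
    rcases hv' with hv' | ⟨hi, u, hu, huv⟩
    · exact conquered_subset_append l [i] (ih hv')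
    · obtain ⟨p, hp⟩ := exists_walk_conquered l hu
      obtain ⟨w, hw, hwy⟩ := exists_mem_closedNbhd hb (p.concat huv)
      rw [SimpleGraph.Walk.support_concat, List.mem_append, List.mem_singleton] at hw
      rcases hw with hw | rfl
      · rcases hwy with rfl | hwy
        · exact conquered_subset_append l [i] (hp _ hw)
        · rw [conquered_append_singleton]
          exact Or.inr ⟨hy.trans hi, w, hp _ hw, hwy.symm⟩
      · rcases hwy with rfl | hwy
        · exact hv
        · exact absurd hy (hc _ _ hwy)

/-- The cost of a walk if the vertices that satisfy `M` have weight `0` and the others `1`. -/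
noncomputable def walkCost (M : V → Prop) {u v : V} (p : G.Walk u v) : ℕ :=
  open Classical in (p.support.map fun a => if M a then 0 else 1).sum

theorem cost_eq_walkCost {u v : V} (p : G.Walk u v) :
    cost G x₀ c p = walkCost (IsClassMax G x₀ c) p := rfl

theorem walkCost_mono {M M' : V → Prop} (h : ∀ v, M v → M' v) {u v : V} (p : G.Walk u v) :
    walkCost M' p ≤ walkCost M p := by
  unfold walkCost
  refine List.sum_le_sum fun a _ => ?_
  by_cases h1 : M a
  · simp [h1, h a h1]
  · simp only [h1, if_false]
    split_ifs <;> simp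

theorem walkCost_concat (M : V → Prop) {u v w : V} (p : G.Walk u v) (h : G.Adj v w) :
    walkCost M (p.concat h) = walkCost M p + (open Classical in if M w then 0 else 1) := by
  simp [walkCost, SimpleGraph.Walk.support_concat]

/-- The colours all of whose vertices belong to `T`. -/
def fullColours (c : V → C) (T : Set V) : Set C := {i ∈ Set.range c | ∀ y, c y = i → y ∈ T}

theorem fullColours_mono {T T' : Set V} (h : T ⊆ T') : fullColours c T ⊆ fullColours c T' :=
  fun _ hi => ⟨hi.1, fun y hy => h (hi.2 y hy)⟩

theorem mem_conquered_of_mem (l l' : List C) {u v : V} (hu : u ∈ conquered G x₀ c l)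
    (huv : G.Adj u v) (hv : c v ∈ l') : v ∈ conquered G x₀ c (l ++ l') := by
  obtain ⟨a, b, rfl⟩ := List.append_of_mem hv
  have := mem_conquered_of_adj (conquered_subset_append l a hu) huv
  have := conquered_subset_append _ b this
  simpa using this

theorem sum_eq_length_filter (M : V → Prop) [DecidablePred M] (s : List V) :
    (s.map fun a => if M a then 0 else 1).sum = (s.filter fun a => ¬ M a).length := by
  induction s with
  | nil => rfl
  | cons a s ih =>
    by_cases h : M a
    · simp [h, ih]
    · simp [h, ih, Nat.add_comm]

variable [Fintype V]

theorem fullColours_finite (T : Set V) : (fullColours c T).Finite :=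
  (Set.finite_range c).subset fun _ h => h.1

/-- Each vertex newly conquered along the walk either has weight 1 or completes its colour. The `+
1` counts the initial colour of the source. -/
theorem exists_calls_walk (hc : ∀ u v, G.Adj u v → c u ≠ c v) {v : V} (p : G.Walk x₀ v) :
    ∃ l : List C, (∀ u ∈ p.support, u ∈ conquered G x₀ c l) ∧
      l.length + 1 ≤ walkCost (IsClassMax G x₀ c) p +
        (fullColours c (conquered G x₀ c l)).ncard := by
  -- Reversal lets the induction extend the walk at its far end.
  obtain ⟨q, rfl⟩ : ∃ q : G.Walk v x₀, p = q.reverse := ⟨p.reverse, by simp⟩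
  induction q with
  | nil =>
    rename_i x₀
    refine ⟨[], by simpa using source_mem_conquered [], ?_⟩
    by_cases hm : IsClassMax G x₀ c x₀
    · have : c x₀ ∈ fullColours c (conquered G x₀ c []) :=
        ⟨⟨x₀, rfl⟩, (isClassMax_iff hc x₀).1 hm [] (source_mem_conquered [])⟩
      have := (Set.ncard_pos (fullColours_finite _)).2 ⟨_, this⟩
      simp only [List.length_nil]
      omega
    · simp [walkCost, hm]
  | @cons w u x₀ h q ih =>
    rw [SimpleGraph.Walk.reverse_cons, ← SimpleGraph.Walk.concat_eq_append]
    obtain ⟨l, hl, hlen⟩ := ih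
    have hu : u ∈ conquered G x₀ c l := hl u (by simp)
    by_cases hw : w ∈ conquered G x₀ c l
    · refine ⟨l, fun a ha => ?_, ?_⟩
      · rw [SimpleGraph.Walk.support_concat, List.mem_append, List.mem_singleton] at ha
        rcases ha with ha | rfl
        exacts [hl a ha, hw]
      · rw [walkCost_concat]
        omega
    · have hw' := mem_conquered_of_adj hu h.symm
      refine ⟨l ++ [c w], fun a ha => ?_, ?_⟩
      · rw [SimpleGraph.Walk.support_concat, List.mem_append, List.mem_singleton] at ha
        rcases ha with ha | rfl
        exacts [conquered_subset_append l _ (hl a ha), hw']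
      · rw [walkCost_concat]
        have hmono := fullColours_mono (c := c)
          (conquered_subset_append (G := G) (x₀ := x₀) (c := c) l [c w])
        by_cases hm : IsClassMax G x₀ c w
        · have hfull : c w ∈ fullColours c (conquered G x₀ c (l ++ [c w])) :=
            ⟨⟨w, rfl⟩, (isClassMax_iff hc w).1 hm _ hw'⟩
          have := Set.ncard_lt_ncard ⟨hmono, fun h => hw ((h hfull).2 w rfl)⟩
            (fullColours_finite _)
          simp only [hm, if_true, List.length_append, List.length_singleton]
          omega
        · have := Set.ncard_le_ncard hmono (fullColours_finite _)
          simp only [hm, if_false, List.length_append, List.length_singleton]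
          omega

/-- Winning along a dominating walk. -/
theorem exists_wins_of_walk (hc : ∀ u v, G.Adj u v → c u ≠ c v) {v : V}
    (hv : Terminal G x₀ v) (p : G.Walk x₀ v) :
    ∃ l : List C, Wins G x₀ c l ∧
      l.length + 1 ≤ walkCost (IsClassMax G x₀ c) p + (Set.range c).ncard := by
  obtain ⟨l, hl, hlen⟩ := exists_calls_walk hc p
  have hfin : (Set.range c \ fullColours c (conquered G x₀ c l)).Finite :=
    (Set.finite_range c).subset Set.sdiff_subset
  refine ⟨l ++ hfin.toFinset.toList, ?_, ?_⟩
  · rw [wins_iff hc, Set.eq_univ_iff_forall]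
    intro y
    obtain ⟨w, hw, hwy⟩ := exists_mem_closedNbhd (hv y) p
    rcases hwy with rfl | hwy
    · exact conquered_subset_append _ _ (hl _ hw)
    · by_cases hy : c y ∈ fullColours c (conquered G x₀ c l)
      · exact conquered_subset_append _ _ (hy.2 y rfl)
      · exact mem_conquered_of_mem _ _ (hl w hw) hwy.symm (by simp [hy])
  · have h1 : hfin.toFinset.card = (Set.range c \ fullColours c (conquered G x₀ c l)).ncard :=
      (Set.ncard_eq_toFinset_card _ hfin).symm
    have h2 := Set.ncard_sdiff_add_ncard_of_subset
      (show fullColours c (conquered G x₀ c l) ⊆ Set.range c from fun _ h => h.1)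
      (Set.finite_range c)
    rw [List.length_append, Finset.length_toList, h1]
    omega

/-- Every winning sequence yields a cheap path to any terminal vertex. -/
theorem exists_cheap_walk (hG : ATFree G) (hx₀ : IsExtreme G x₀)
    (hc : ∀ u v, G.Adj u v → c u ≠ c v) {v : V} (hv : Terminal G x₀ v) {l : List C}
    (hl : Wins G x₀ c l) :
    ∃ p : G.Walk x₀ v, p.IsPath ∧
      walkCost (BlockMax G x₀ c) p + (Set.range c).ncard ≤ l.length + 1 := by
  classical
  rw [wins_iff hc] at hl
  have hex : ∀ u, ∃ j, u ∈ conquered G x₀ c (l.take j) := fun u =>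
    ⟨l.length, by rw [List.take_length, hl]; trivial⟩
  -- `τ u` is the number of calls after which `u` is first conquered; it is 0 only for the source.
  set τ : V → ℕ := fun u => Nat.find (hex u) with hτdef
  have hspec : ∀ u, u ∈ conquered G x₀ c (l.take (τ u)) := fun u => Nat.find_spec (hex u)
  have hmin : ∀ u j, u ∈ conquered G x₀ c (l.take j) → τ u ≤ j := fun u j h =>
    Nat.find_min' (hex u) h
  have hle : ∀ u, τ u ≤ l.length := fun u => hmin u _ (by rw [List.take_length, hl]; trivial)
  have h0 : ∀ u, τ u = 0 ↔ u = x₀ := by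
    intro u
    constructor
    · intro h
      have := hspec u
      rw [h] at this
      exact this
    · rintro rfl
      have := hmin u 0 (source_mem_conquered _)
      omega
  have hstep : ∀ u, u ≠ x₀ → ∃ j, ∃ hj : j < l.length, τ u = j + 1 ∧ c u = l[j] ∧
      ∃ w, G.Adj w u ∧ τ w < τ u := by
    intro u hu
    have hpos : τ u ≠ 0 := fun h => hu ((h0 u).1 h)
    obtain ⟨j, hj⟩ := Nat.exists_eq_succ_of_ne_zero hpos
    have hjl : j < l.length := by have := hle u; omega
    have hs := hspec u
    rw [hj, Nat.succ_eq_add_one, List.take_succ_eq_append_getElem hjl,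
      conquered_append_singleton] at hs
    rcases hs with hs | ⟨hs, w, hw, hwu⟩
    · have := hmin u j hs
      omega
    · have := hmin w j hw
      exact ⟨j, hjl, hj, hs, w, hwu, by omega⟩
  have hcol : ∀ u w, τ u = τ w → c u = c w := by
    intro u w h
    by_cases hu : u = x₀
    · have hw : w = x₀ := (h0 w).1 (h ▸ (h0 u).2 hu)
      rw [hu, hw]
    · have hw : w ≠ x₀ := fun hw => hu ((h0 u).1 (h.trans ((h0 w).2 hw)))
      obtain ⟨j, hj, h1, h2, -⟩ := hstep u hu
      obtain ⟨j', hj', h1', h2', -⟩ := hstep w hw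
      obtain rfl : j = j' := by omega
      rw [h2, h2']
  obtain ⟨p, hp, hgood⟩ := exists_good_walk hG hx₀ c τ h0
    (fun u hu => by obtain ⟨-, -, -, -, h⟩ := hstep u hu; exact h) hv
  have hnd : (p.support.map τ).Nodup := hp.imp fun h => h.ne
  refine ⟨p, SimpleGraph.Walk.IsPath.mk' hnd.of_map, ?_⟩
  have hlast : ∀ i ∈ Set.range c, ∃ u, c u = i ∧ ∀ w, c w = i → τ w ≤ τ u := by
    rintro i ⟨a, rfl⟩
    obtain ⟨u, hu, hmax⟩ := Finset.exists_max_image (Finset.univ.filter fun u => c u = c a) τ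
      ⟨a, by simp⟩
    exact ⟨u, by simpa using hu, fun w hw => hmax w (by simpa using hw)⟩
  have : Nonempty V := ⟨x₀⟩
  choose! e he hemax using hlast
  -- `A` holds the times of the charged vertices of the path, `B` the last times of the colours.
  -- Vertices conquered at the same time have the same colour, so `B` has one element per colour.
  set A : Finset ℕ := ((p.support.filter fun a => ¬ BlockMax G x₀ c a).map τ).toFinset with hA
  set B : Finset ℕ := (Set.finite_range c).toFinset.image (fun i => τ (e i)) with hB
  have hAcard : A.card = walkCost (BlockMax G x₀ c) p := by
    rw [hA, List.toFinset_card_of_nodup, List.length_map, walkCost, sum_eq_length_filter]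
    · exact hnd.sublist (List.filter_sublist.map τ)
  have hBcard : B.card = (Set.range c).ncard := by
    rw [hB, Finset.card_image_of_injOn, Set.ncard_eq_toFinset_card _ (Set.finite_range c)]
    intro i hi i' hi' h
    rw [Set.Finite.coe_toFinset] at hi hi'
    rw [← he i hi, ← he i' hi']
    exact hcol _ _ h
  have hdisj : Disjoint A B := by
    rw [Finset.disjoint_left]
    intro t htA htB
    simp only [hA, hB, List.mem_toFinset, List.mem_map, List.mem_filter, Finset.mem_image,
      Set.Finite.mem_toFinset, decide_eq_true_eq] at htA htB
    obtain ⟨u, ⟨hu, hnb⟩, rfl⟩ := htA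
    obtain ⟨i, hi, hiu⟩ := htB
    rcases hgood u hu with h | ⟨u', hu', hlt⟩
    · exact hnb h
    · have h1 := hcol _ _ hiu
      have h2 := hemax i hi u' (by rw [hu', ← h1, he i hi])
      omega
  have hsub : A ∪ B ⊆ Finset.range (l.length + 1) := by
    intro t ht
    simp only [hA, hB, Finset.mem_union, List.mem_toFinset, List.mem_map, Finset.mem_image] at ht
    rw [Finset.mem_range]
    rcases ht with ⟨u, -, rfl⟩ | ⟨i, -, rfl⟩
    · have := hle u; omega
    · have := hle (e i); omega
  have := Finset.card_le_card hsub
  rw [Finset.card_union_of_disjoint hdisj, hAcard, hBcard, Finset.card_range] at this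
  exact this

theorem exists_wins (hG : G.Connected) (hc : ∀ u v, G.Adj u v → c u ≠ c v) {v : V}
    (hv : Terminal G x₀ v) : ∃ m, IsOptimum G x₀ c m := by
  classical
  obtain ⟨p⟩ := hG x₀ v
  obtain ⟨l, hl, -⟩ := exists_wins_of_walk (c := c) hc hv p
  have hex : ∃ m, ∃ l : List C, l.length = m ∧ Wins G x₀ c l := ⟨_, l, rfl, hl⟩
  exact ⟨Nat.find hex, Nat.find_spec hex, fun m hm => Nat.find_min' hex hm⟩

/-- The minimal number of moves is determined by the cheapest paths to any terminal vertex, also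
if only block maxima have weight `0`. -/
theorem isOptimum_of_walkCost (hG : G.Connected) (hAT : ATFree G) (hx₀ : IsExtreme G x₀)
    (hc : ∀ u v, G.Adj u v → c u ≠ c v) {v : V} (hv : Terminal G x₀ v) {w : ℕ}
    (hw : ∃ p : G.Walk x₀ v, walkCost (BlockMax G x₀ c) p = w)
    (hmin : ∀ p : G.Walk x₀ v, w ≤ walkCost (BlockMax G x₀ c) p) :
    IsOptimum G x₀ c (w + (Set.range c).ncard - 1) := by
  obtain ⟨m, hm⟩ := exists_wins hG hc hv
  obtain ⟨l, rfl, hl⟩ := hm.1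
  obtain ⟨p, -, hp⟩ := exists_cheap_walk hAT hx₀ hc hv hl
  obtain ⟨q, hq⟩ := hw
  obtain ⟨l', hl', hlen⟩ := exists_wins_of_walk (c := c) hc hv q
  have h1 := hm.2 ⟨l', rfl, hl'⟩
  have h2 := walkCost_mono (fun a (h : BlockMax G x₀ c a) => h.isClassMax hc) q
  have h3 := hmin p
  -- The optimal `l` bounds the block cost of `p` from above, and `l` is no longer than the sequence
  -- played along `q`; passing from block to class weights only lowers the cost, so equality holds
  -- throughout.
  have : l.length = w + (Set.range c).ncard - 1 := by omega
  rwa [this] at hm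

theorem exists_optimum_cheapest (hG : G.Connected) (hAT : ATFree G) (hx₀ : IsExtreme G x₀)
    (hc : ∀ u v, G.Adj u v → c u ≠ c v) {x : V} (hx : IsFarthest G x₀ x) :
    ∃ m w : ℕ, IsOptimum G x₀ c m ∧ IsCheapest G x₀ c (farMaxima G x₀ c x) w ∧
      m + 1 = w + (Set.range c).ncard := by
  classical
  have hxf := mem_farSet_self (G := G) x₀ x
  have hter : ∀ v ∈ farSet G x₀ x, Terminal G x₀ v := fun v hv =>
    terminal_of_mem_farSet hAT hx₀ hx hv
  have hv := hter x hxf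
  obtain ⟨m, hm⟩ := exists_wins hG hc hv
  obtain ⟨l, rfl, hl⟩ := hm.1
  obtain ⟨p, hpath, hp⟩ := exists_cheap_walk hAT hx₀ hc hv hl
  -- A terminal vertex is a block maximum, whatever its colour.
  have hxm : x ∈ farMaxima G x₀ c x := ⟨hxf, BlockMax.isClassMax hc fun y _ => hv y⟩
  have hex : ∃ w, ∃ v ∈ farMaxima G x₀ c x, ∃ p : G.Walk x₀ v, p.IsPath ∧ cost G x₀ c p = w :=
    ⟨_, x, hxm, p, hpath, rfl⟩
  refine ⟨l.length, Nat.find hex, hm, ⟨Nat.find_spec hex, fun w hw => Nat.find_min' hex hw⟩, ?_⟩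
  obtain ⟨v, hv', q, -, hq⟩ := Nat.find_spec hex
  obtain ⟨l', hl', hlen⟩ := exists_wins_of_walk hc (hter v hv'.1) q
  have h1 := hm.2 ⟨l', rfl, hl'⟩
  have h2 : Nat.find hex ≤ cost G x₀ c p := Nat.find_min' hex ⟨x, hxm, p, hpath, rfl⟩
  have h3 := walkCost_mono (fun a (h : BlockMax G x₀ c a) => h.isClassMax hc) p
  rw [cost_eq_walkCost] at h2 hq
  omega

end GameLemmas

/-! ### Correctness of Bellman–Ford for vertex weights -/

section Distance

variable {n : ℕ} {G : SimpleGraph (Fin n)} {x₀ : Fin n} {w : Fin n → ℕ}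

/-- The sum of the weights of the vertices of a walk. -/
def weightSum {V : Type*} {G : SimpleGraph V} (w : V → ℕ) {u v : V} (p : G.Walk u v) : ℕ :=
  (p.support.map w).sum

theorem weightSum_concat {V : Type*} {G : SimpleGraph V} (w : V → ℕ) {a u v : V}
    (p : G.Walk a u) (h : G.Adj u v) : weightSum w (p.concat h) = weightSum w p + w v := by
  simp [weightSum, SimpleGraph.Walk.support_concat]

/-- The entries of `d` are the costs of cheapest walks from `x₀`. -/
def IsDist (G : SimpleGraph (Fin n)) (x₀ : Fin n) (w : Fin n → ℕ) (d : ℕ → ℕ) : Prop :=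
  ∀ v : Fin n, (∃ p : G.Walk x₀ v, weightSum w p = d v) ∧ ∀ p : G.Walk x₀ v, d v ≤ weightSum w p

/-- The entries of `d` are costs of walks, or the default value `n + 1`. -/
def Sound (G : SimpleGraph (Fin n)) (x₀ : Fin n) (w : Fin n → ℕ) (d : ℕ → ℕ) : Prop :=
  ∀ v : Fin n, d v ≤ n + 1 ∧ (d v = n + 1 ∨ ∃ p : G.Walk x₀ v, weightSum w p = d v)

/-- `d` is at most the cost of all walks with at most `j` edges. -/
def ShortBound (G : SimpleGraph (Fin n)) (x₀ : Fin n) (w : Fin n → ℕ) (j : ℕ) (d : ℕ → ℕ) :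
    Prop :=
  ∀ (v : Fin n) (p : G.Walk x₀ v), p.length ≤ j → d v ≤ weightSum w p

/-- `d` arises from `d₀` by relaxing the edges `(a, b)` that precede `(u, v)` in lexicographic
order. -/
def Relaxed (G : SimpleGraph (Fin n)) (w : Fin n → ℕ) (d₀ d : ℕ → ℕ) (u v : ℕ) : Prop :=
  (∀ a : Fin n, d a ≤ d₀ a) ∧
    ∀ a b : Fin n, G.Adj a b → ((a : ℕ) < u ∨ (a : ℕ) = u ∧ (b : ℕ) < v) → d b ≤ d₀ a + w b

theorem Relaxed.refl (d : ℕ → ℕ) : Relaxed G w d d 0 0 :=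
  ⟨fun _ => le_rfl, fun a b _ h => by omega⟩

theorem Relaxed.next_row {d₀ d : ℕ → ℕ} {u : ℕ} (h : Relaxed G w d₀ d u n) :
    Relaxed G w d₀ d (u + 1) 0 :=
  ⟨h.1, fun a b hab h' => h.2 a b hab (by have := b.2; omega)⟩

theorem Relaxed.step_of_not {d₀ d : ℕ → ℕ} {u v : Fin n} (h : Relaxed G w d₀ d u v)
    (hn : G.Adj u v → d v ≤ d u + w v) : Relaxed G w d₀ d u (v + 1) := by
  refine ⟨h.1, fun a b hab h' => ?_⟩
  by_cases hb : (a : ℕ) = u ∧ (b : ℕ) = v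
  · obtain rfl : a = u := Fin.ext hb.1
    obtain rfl : b = v := Fin.ext hb.2
    have := h.1 a
    have := hn hab
    omega
  · exact h.2 a b hab (by omega)

theorem Relaxed.update {d₀ d : ℕ → ℕ} {u v : Fin n} (h : Relaxed G w d₀ d u v)
    (hlt : d u + w v < d v) :
    Relaxed G w d₀ (Function.update d v (d u + w v)) u (v + 1) := by
  have hle : ∀ a : ℕ, Function.update d v (d u + w v) a ≤ d a := by
    intro a
    rw [Function.update_apply]
    split_ifs with h
    · rw [h]; omega
    · exact le_rfl
  refine ⟨fun a => (hle a).trans (h.1 a), fun a b hab h' => ?_⟩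
  by_cases hb : (a : ℕ) = u ∧ (b : ℕ) = v
  · obtain rfl : a = u := Fin.ext hb.1
    obtain rfl : b = v := Fin.ext hb.2
    rw [Function.update_self]
    have := h.1 a
    omega
  · exact (hle b).trans (h.2 a b hab (by omega))

theorem Sound.update {d : ℕ → ℕ} (h : Sound G x₀ w d) {u v : Fin n} (huv : G.Adj u v)
    (hlt : d u + w v < d v) : Sound G x₀ w (Function.update d v (d u + w v)) := by
  intro b
  by_cases hb : b = v
  · subst hb
    rw [Function.update_self]
    have hb' := (h b).1
    refine ⟨by omega, Or.inr ?_⟩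
    -- An edge out of a vertex with the default value `n + 1` never gives a strict improvement.
    rcases (h u).2 with hu | ⟨p, hp⟩
    · omega
    · exact ⟨p.concat huv, by rw [weightSum_concat, hp]⟩
  · rw [Function.update_of_ne (fun e => hb (Fin.ext e))]
    exact h b

theorem ShortBound.succ {d₀ d : ℕ → ℕ} {j : ℕ} (h : ShortBound G x₀ w j d₀)
    (hr : Relaxed G w d₀ d n 0) : ShortBound G x₀ w (j + 1) d := by
  intro v p hp
  by_cases hpj : p.length ≤ j
  · exact (hr.1 v).trans (h v p hpj)
  · obtain ⟨u, q, huv, rfl⟩ := (SimpleGraph.Walk.not_nil_iff_lt_length.2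
      (by omega) : ¬ p.Nil) |> fun hnil =>
        (⟨_, p.dropLast, p.adj_penultimate hnil, (p.concat_dropLast _).symm⟩ :
          ∃ (u : Fin n) (q : G.Walk x₀ u) (h : G.Adj u v), p = q.concat h)
    rw [SimpleGraph.Walk.length_concat] at hp
    rw [weightSum_concat]
    have := hr.2 u v huv (Or.inl u.2)
    have := h u q (by omega)
    omega

theorem exists_path_weightSum_le {v : Fin n} (p : G.Walk x₀ v) :
    ∃ q : G.Walk x₀ v, q.IsPath ∧ weightSum w q ≤ weightSum w p := by
  obtain ⟨l, hl, hs⟩ :=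
    List.subperm_of_subset p.bypass_isPath.support_nodup p.support_bypass_subset_support
  refine ⟨p.bypass, p.bypass_isPath, ?_⟩
  unfold weightSum
  rw [← (hl.map w).sum_eq]
  exact (hs.map w).sum_le_sum (fun _ _ => Nat.zero_le _)

/-- Cheapest walks may be taken to be paths, which have at most `n` vertices. Hence `n` rounds
suffice, and no true distance reaches the default `n + 1`. -/
theorem IsDist.of_rounds (hG : G.Connected) (hw : ∀ v, w v ≤ 1) {d : ℕ → ℕ}
    (hs : Sound G x₀ w d) (hb : ShortBound G x₀ w n d) : IsDist G x₀ w d := by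
  have hle : ∀ (v : Fin n) (p : G.Walk x₀ v), d v ≤ weightSum w p := by
    intro v p
    obtain ⟨q, hq, hqp⟩ := exists_path_weightSum_le (w := w) p
    have := hq.length_lt
    rw [Fintype.card_fin] at this
    exact (hb v q this.le).trans hqp
  refine fun v => ⟨?_, hle v⟩
  rcases (hs v).2 with h | h
  · exfalso
    obtain ⟨p⟩ := hG x₀ v
    obtain ⟨q, hq, -⟩ := exists_path_weightSum_le (w := w) p
    have h1 := hle v q
    have h2 : weightSum w q ≤ q.support.length := by
      have := List.sum_le_card_nsmul (q.support.map w) 1 (by simpa using fun a _ => hw a)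
      simpa [weightSum] using this
    have h3 := hq.length_lt
    rw [Fintype.card_fin] at h3
    rw [SimpleGraph.Walk.length_support] at h2
    omega
  · exact h

open Classical in
-- This lets the shortest-path routine double as the search for the component of `G - N[y]` that
-- contains the source.
theorem IsDist.eq_zero_iff {y : Fin n} {d : ℕ → ℕ}
    (h : IsDist G x₀ (fun v => if v ∈ closedNbhd G y then 1 else 0) d) (v : Fin n) :
    d v = 0 ↔ v ∈ block G y x₀ := by
  have key : ∀ p : G.Walk x₀ v, weightSum (fun v => if v ∈ closedNbhd G y then 1 else 0) p = 0 ↔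
      ∀ a ∈ p.support, a ∉ closedNbhd G y := by
    intro p
    simp [weightSum, List.sum_eq_zero_iff]
  constructor
  · intro h0
    obtain ⟨p, hp⟩ := (h v).1
    exact ⟨p, (key p).1 (hp.trans h0)⟩
  · rintro ⟨p, hp⟩
    have := (h v).2 p
    rw [(key p).2 hp] at this
    omega

end Distance

/-! ### Timed Hoare rules for the random access machine -/

section Machine

/-- `P` halts from `s` within `T` steps in a state that satisfies `Q`. -/
def Runs (P : Prog) (T : ℕ) (s : State) (Q : State → Prop) : Prop :=
  ∃ t s', Exec P s t s' ∧ t ≤ T ∧ Q s'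

theorem Runs.mono {P : Prog} {T T' : ℕ} {s : State} {Q Q' : State → Prop} (h : Runs P T s Q)
    (hT : T ≤ T') (hQ : ∀ s', Q s' → Q' s') : Runs P T' s Q' := by
  obtain ⟨t, s', h1, h2, h3⟩ := h
  exact ⟨t, s', h1, h2.trans hT, hQ _ h3⟩

theorem Runs.set {r : ℕ} {e : Expr} {T : ℕ} {s : State} {Q : State → Prop}
    (h : Q (s.setReg r (e.eval s))) (hT : e.steps + 1 ≤ T := by decide) :
    Runs (.set r e) T s Q :=
  ⟨_, _, .set r e s, hT, h⟩

theorem Runs.put {a : ℕ} {i e : Expr} {T : ℕ} {s : State} {Q : State → Prop}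
    (h : Q (s.setArr a (i.eval s) (e.eval s))) (hT : i.steps + e.steps + 1 ≤ T := by decide) :
    Runs (.put a i e) T s Q :=
  ⟨_, _, .put a i e s, hT, h⟩

theorem Runs.seq {P P' : Prog} {T T' : ℕ} {s : State} {Q Q' : State → Prop} (h : Runs P T s Q)
    (h' : ∀ s', Q s' → Runs P' T' s' Q') : Runs (.seq P P') (T + T') s Q' := by
  obtain ⟨t, s', h1, h2, h3⟩ := h
  obtain ⟨t', s'', h1', h2', h3'⟩ := h' s' h3
  exact ⟨_, _, .seq _ _ _ _ _ _ _ h1 h1', by omega, h3'⟩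

theorem Runs.ifLt {e₁ e₂ : Expr} {P P' : Prog} {T : ℕ} {s : State} {Q : State → Prop}
    (h : e₁.eval s < e₂.eval s → Runs P (T - (e₁.steps + e₂.steps + 1)) s Q)
    (h' : ¬ e₁.eval s < e₂.eval s → Runs P' (T - (e₁.steps + e₂.steps + 1)) s Q)
    (hT : e₁.steps + e₂.steps + 1 ≤ T := by decide) :
    Runs (.ifLt e₁ e₂ P P') T s Q := by
  by_cases hlt : e₁.eval s < e₂.eval s
  · obtain ⟨t, s', h1, h2, h3⟩ := h hlt
    exact ⟨_, _, .ifTrue _ _ _ _ _ _ _ hlt h1, by omega, h3⟩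
  · obtain ⟨t, s', h1, h2, h3⟩ := h' hlt
    exact ⟨_, _, .ifFalse _ _ _ _ _ _ _ hlt h1, by omega, h3⟩

/-- The program that does nothing. -/
def Prog.skip : Prog := .set 0 (.reg 0)

theorem Runs.skip {T : ℕ} {s : State} {Q : State → Prop} (h : Q s) (hT : 2 ≤ T := by decide) :
    Runs .skip T s Q := by
  refine Runs.set ?_ hT
  have : s.setReg 0 ((Expr.reg 0).eval s) = s := by simp [State.setReg, Expr.eval]
  rwa [this]

/-- Execute `P` for the values `0, …, n - 1` of register `r`, where `n` is in register `0`. -/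
def Prog.loop (r : ℕ) (P : Prog) : Prog :=
  .seq (.set r (.lit 0)) (.whileLt (.reg r) (.reg 0) (.seq P (.set r (.add (.reg r) (.lit 1)))))

/-- The running time of a loop. -/
def loopTime (n T : ℕ) : ℕ := n * (T + 7) + 5

/-- A pass costs `T` for the body, 3 for the test and 4 for the increment; the remaining 5 are the
initialization and the last, failing test. -/
theorem Runs.loop {r : ℕ} {P : Prog} {T n : ℕ} {s : State} (Inv : ℕ → State → Prop)
    (hn : ∀ i s, Inv i s → s.reg 0 = n) (h0 : Inv 0 (s.setReg r 0))
    (hstep : ∀ i < n, ∀ s, s.reg r = i → Inv i s →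
      Runs P T s fun s' => s'.reg r = i ∧ Inv (i + 1) (s'.setReg r (i + 1))) :
    Runs (.loop r P) (loopTime n T) s (Inv n) := by
  have H : ∀ m i s, i + m = n → s.reg r = i → Inv i s →
      Runs (.whileLt (.reg r) (.reg 0) (.seq P (.set r (.add (.reg r) (.lit 1)))))
        (m * (T + 7) + 3) s (Inv n) := by
    intro m
    induction m with
    | zero =>
      intro i s him hr hi
      obtain rfl : i = n := by omega
      refine ⟨_, s, .whileFalse _ _ _ _ ?_, ?_, hi⟩
      · simp [Expr.eval, hr, hn _ _ hi]
      · simp [Expr.steps]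
    | succ m ih =>
      intro i s him hr hi
      obtain ⟨t, s', h1, h2, h3, h4⟩ := hstep i (by omega) s hr hi
      obtain ⟨t', s'', h1', h2', h3'⟩ := ih (i + 1) (s'.setReg r (i + 1)) (by omega)
        (by simp [State.setReg]) h4
      have hset := Exec.set r (.add (.reg r) (.lit 1)) s'
      have hev : (Expr.add (.reg r) (.lit 1)).eval s' = i + 1 := by simp [Expr.eval, h3]
      rw [hev] at hset
      refine ⟨_, s'', .whileTrue _ _ _ _ _ _ _ _ ?_ (.seq _ _ _ _ _ _ _ h1 hset) h1', ?_, h3'⟩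
      · simp only [Expr.eval, hr, hn _ _ hi]
        omega
      · simp only [Expr.steps, Nat.add_mul]
        omega
  have := Runs.seq (Runs.set (r := r) (e := .lit 0) (T := 2) (s := s)
    (Q := fun s' => s' = s.setReg r 0) rfl)
    (fun s' hs' => by
      subst hs'
      exact H n 0 _ (by omega) (by simp [State.setReg]) h0)
  refine this.mono ?_ fun _ h => h
  rw [loopTime]
  omega

/-- `s'` differs from `s` at most in the registers `rs` and the arrays `as`. -/
def Frame (rs as : List ℕ) (s s' : State) : Prop :=
  (∀ r, r ∉ rs → s'.reg r = s.reg r) ∧ ∀ a, a ∉ as → s'.arr a = s.arr a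

theorem Frame.refl (rs as : List ℕ) (s : State) : Frame rs as s s :=
  ⟨fun _ _ => rfl, fun _ _ => rfl⟩

theorem Frame.trans {rs as rs' as' : List ℕ} {s s' s'' : State} (h : Frame rs as s s')
    (h' : Frame rs' as' s' s'') (hr : rs' ⊆ rs := by decide) (ha : as' ⊆ as := by decide) :
    Frame rs as s s'' :=
  ⟨fun r h1 => (h'.1 r fun h2 => h1 (hr h2)).trans (h.1 r h1),
    fun a h1 => (h'.2 a fun h2 => h1 (ha h2)).trans (h.2 a h1)⟩

theorem Frame.mono {rs as rs' as' : List ℕ} {s s' : State} (h : Frame rs as s s')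
    (hr : rs ⊆ rs' := by decide) (ha : as ⊆ as' := by decide) : Frame rs' as' s s' :=
  ⟨fun r h1 => h.1 r fun h2 => h1 (hr h2), fun a h1 => h.2 a fun h2 => h1 (ha h2)⟩

theorem Frame.setReg {rs as : List ℕ} {s s' : State} (h : Frame rs as s s') {r : ℕ} (v : ℕ)
    (hr : r ∈ rs := by decide) : Frame rs as s (s'.setReg r v) :=
  ⟨fun r' h' => by
    rw [← h.1 r' h']
    exact Function.update_of_ne (fun e : r' = r => h' (e ▸ hr)) _ _, h.2⟩

theorem Frame.setArr {rs as : List ℕ} {s s' : State} (h : Frame rs as s s') {a : ℕ} (i v : ℕ)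
    (ha : a ∈ as := by decide) : Frame rs as s (s'.setArr a i v) :=
  ⟨h.1, fun a' h' => by
    rw [← h.2 a' h']
    exact Function.update_of_ne (fun e : a' = a => h' (e ▸ ha)) _ _⟩

theorem setReg_reg (s : State) (r v r' : ℕ) :
    (s.setReg r v).reg r' = if r' = r then v else s.reg r' := Function.update_apply ..

theorem setReg_arr (s : State) (r v : ℕ) : (s.setReg r v).arr = s.arr := rfl

theorem setArr_reg (s : State) (a i v : ℕ) : (s.setArr a i v).reg = s.reg := rfl

theorem setArr_arr (s : State) (a i v a' : ℕ) :
    (s.setArr a i v).arr a' = if a' = a then Function.update (s.arr a) i v else s.arr a' :=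
  Function.update_apply ..

end Machine

/-! ### The shortest-path routine -/

section Program

/-- Relax the edge from register `6` to register `7`; register `8` is its index in array `0`,
array `2` holds the weights, array `3` the distances. -/
def relaxEdge : Prog :=
  .seq
    (.ifLt (.lit 0) (.get 0 (.reg 8))
      (.ifLt (.add (.get 3 (.reg 6)) (.get 2 (.reg 7))) (.get 3 (.reg 7))
        (.put 3 (.reg 7) (.add (.get 3 (.reg 6)) (.get 2 (.reg 7)))) .skip) .skip)
    (.set 8 (.add (.reg 8) (.lit 1)))

/-- Compute the distances from the source for the weights in array `2`. -/
def distances : Prog :=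
  .seq (.loop 7 (.put 3 (.reg 7) (.add (.reg 0) (.lit 1))))
    (.seq (.put 3 (.reg 2) (.get 2 (.reg 2)))
      (.loop 5 (.seq (.set 8 (.lit 0)) (.loop 6 (.loop 7 relaxEdge)))))

/-- The running time of `distances`. -/
def distancesTime (n : ℕ) : ℕ :=
  loopTime n 5 + (4 + loopTime n (2 + loopTime n (loopTime n 30)))

variable {n k : ℕ} {G : SimpleGraph (Fin n)} {c : Fin n → Fin k} {x₀ : Fin n} {w : Fin n → ℕ}

/-- Array `0` holds the adjacency matrix, and registers `0` and `2` the order and the source. -/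
def Holds (G : SimpleGraph (Fin n)) (x₀ : Fin n) (s : State) : Prop :=
  s.reg 0 = n ∧ s.reg 2 = x₀ ∧
    ∀ u v : Fin n, (G.Adj u v → s.arr 0 (u * n + v) = 1) ∧ (¬ G.Adj u v → s.arr 0 (u * n + v) = 0)

theorem Holds.of_frame {rs as : List ℕ} {s s' : State} (h : Holds G x₀ s) (hf : Frame rs as s s')
    (h0 : 0 ∉ rs := by decide)
    (h2 : 2 ∉ rs := by decide) (ha : 0 ∉ as := by decide) : Holds G x₀ s' := by
  refine ⟨(hf.1 0 h0).trans h.1, (hf.1 2 h2).trans h.2.1, ?_⟩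
  rw [hf.2 0 ha]
  exact h.2.2

theorem runs_relaxEdge {s : State} {u v : Fin n} {d₀ : ℕ → ℕ} (hs : Holds G x₀ s)
    (hw : ∀ v : Fin n, s.arr 2 v = w v) (h6 : s.reg 6 = u) (h7 : s.reg 7 = v)
    (h8 : s.reg 8 = u * n + v) (hd : Sound G x₀ w (s.arr 3))
    (hr : Relaxed G w d₀ (s.arr 3) u v) :
    Runs relaxEdge 30 s fun s' => Frame [8] [3] s s' ∧ s'.reg 8 = u * n + (v + 1) ∧
      Sound G x₀ w (s'.arr 3) ∧ Relaxed G w d₀ (s'.arr 3) u (v + 1) := by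
  refine Runs.seq (T := 26) (T' := 4) (Q := fun s' => Frame [] [3] s s' ∧ Sound G x₀ w (s'.arr 3) ∧
    Relaxed G w d₀ (s'.arr 3) u (v + 1)) ?_ ?_
  · refine Runs.ifLt (fun h1 => Runs.ifLt (fun h2 => Runs.put ?_) fun h2 => Runs.skip ?_)
      fun h1 => Runs.skip ?_
    · simp only [Expr.eval, h6, h7, h8, hw] at h1 h2 ⊢
      have hadj : G.Adj u v := by
        by_contra hn
        rw [(hs.2.2 u v).2 hn] at h1
        exact lt_irrefl _ h1
      refine ⟨(Frame.refl _ _ _).setArr _ _, ?_⟩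
      rw [setArr_arr, if_pos rfl]
      exact ⟨hd.update hadj h2, hr.update h2⟩
    · simp only [Expr.eval, h6, h7, hw] at h2
      exact ⟨Frame.refl _ _ _, hd, hr.step_of_not fun _ => not_lt.1 h2⟩
    · simp only [Expr.eval, h8] at h1
      refine ⟨Frame.refl _ _ _, hd, hr.step_of_not fun hadj => ?_⟩
      rw [(hs.2.2 u v).1 hadj] at h1
      exact absurd Nat.one_pos h1
  · rintro s' ⟨hf, h1, h2⟩
    refine Runs.set ⟨hf.mono.setReg _, ?_, h1, h2⟩
    simp only [setReg_reg, if_pos, Expr.eval, hf.1 8 (by decide), h8]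
    omega

/-- Register 8 runs through the matrix indices consecutively, since the machine cannot multiply `u`
by `n`. -/
theorem runs_relaxRow {s : State} {u : Fin n} {d₀ : ℕ → ℕ} (hs : Holds G x₀ s)
    (hw : ∀ v : Fin n, s.arr 2 v = w v) (h6 : s.reg 6 = u)
    (h8 : s.reg 8 = u * n) (hd : Sound G x₀ w (s.arr 3))
    (hr : Relaxed G w d₀ (s.arr 3) u 0) :
    Runs (.loop 7 relaxEdge) (loopTime n 30) s fun s' => Frame [7, 8] [3] s s' ∧
      s'.reg 8 = (u + 1) * n ∧ Sound G x₀ w (s'.arr 3) ∧ Relaxed G w d₀ (s'.arr 3) (u + 1) 0 := by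
  refine (Runs.loop (n := n) (fun v s' => Frame [7, 8] [3] s s' ∧ s'.reg 8 = u * n + v ∧
    Sound G x₀ w (s'.arr 3) ∧ Relaxed G w d₀ (s'.arr 3) u v) ?_ ?_ ?_).mono le_rfl ?_
  · exact fun i s' h => (h.1.1 0 (by decide)).trans hs.1
  · exact ⟨(Frame.refl _ _ _).setReg _, by simp [setReg_reg, h8], hd, hr⟩
  · rintro v hv s' h7 ⟨hf, h8', hd', hr'⟩
    refine (runs_relaxEdge (u := u) (v := ⟨v, hv⟩) (hs.of_frame hf) (w := w) (fun v => ?_) ?_ h7 h8'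
      hd' hr').mono le_rfl ?_
    · rw [hf.2 2 (by decide), hw]
    · rw [hf.1 6 (by decide), h6]
    · rintro s'' ⟨hf', h8'', hd'', hr''⟩
      exact ⟨(hf'.1 7 (by decide)).trans h7, (hf.trans hf').setReg _, h8'', hd'', hr''⟩
  · rintro s' ⟨hf, h8', hd', hr'⟩
    exact ⟨hf, by rw [h8', Nat.succ_mul], hd', hr'.next_row⟩

theorem runs_round {s : State} {j : ℕ} (hs : Holds G x₀ s)
    (hw : ∀ v : Fin n, s.arr 2 v = w v) (hd : Sound G x₀ w (s.arr 3))
    (hb : ShortBound G x₀ w j (s.arr 3)) :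
    Runs (.seq (.set 8 (.lit 0)) (.loop 6 (.loop 7 relaxEdge)))
      (2 + loopTime n (loopTime n 30)) s fun s' => Frame [6, 7, 8] [3] s s' ∧
        Sound G x₀ w (s'.arr 3) ∧ ShortBound G x₀ w (j + 1) (s'.arr 3) := by
  refine Runs.seq (Q := fun s' => s' = s.setReg 8 0) (Runs.set rfl) ?_
  rintro s₁ rfl
  refine (Runs.loop (n := n) (fun u s' => Frame [6, 7, 8] [3] s s' ∧ s'.reg 8 = u * n ∧
    Sound G x₀ w (s'.arr 3) ∧ Relaxed G w (s.arr 3) (s'.arr 3) u 0) ?_ ?_ ?_).mono le_rfl ?_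
  · exact fun i s' h => (h.1.1 0 (by decide)).trans hs.1
  · exact ⟨((Frame.refl _ _ _).setReg _).setReg _, by simp [setReg_reg], hd, Relaxed.refl _⟩
  · rintro u hu s' h6 ⟨hf, h8', hd', hr'⟩
    refine (runs_relaxRow (u := ⟨u, hu⟩) (hs.of_frame hf) (w := w) (fun v => ?_) h6 h8'
      hd' hr').mono le_rfl ?_
    · rw [hf.2 2 (by decide), hw]
    · rintro s'' ⟨hf', h8'', hd'', hr''⟩
      exact ⟨(hf'.1 6 (by decide)).trans h6, (hf.trans hf').setReg _, h8'', hd'', hr''⟩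
  · rintro s' ⟨hf, -, hd', hr'⟩
    exact ⟨hf, hd', hb.succ hr'⟩

theorem runs_distances (hG : G.Connected) {s : State} (hs : Holds G x₀ s)
    (hw : ∀ v : Fin n, s.arr 2 v = w v) (hw1 : ∀ v, w v ≤ 1) :
    Runs distances (distancesTime n) s fun s' => Frame [5, 6, 7, 8] [3] s s' ∧
      IsDist G x₀ w (s'.arr 3) := by
  refine Runs.seq (Runs.loop (n := n) (fun i s' => Frame [7] [3] s s' ∧
    ∀ v < i, s'.arr 3 v = n + 1) ?_ ?_ ?_) ?_
  · exact fun i s' h => (h.1.1 0 (by decide)).trans hs.1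
  · exact ⟨(Frame.refl _ _ _).setReg _, fun v hv => absurd hv (Nat.not_lt_zero v)⟩
  · rintro i hi s' h7 ⟨hf, h⟩
    refine Runs.put ⟨h7, (hf.setArr _ _).setReg _, fun v hv => ?_⟩
    simp only [setReg_arr, setArr_arr, if_pos, Expr.eval, h7, hf.1 0 (by decide), hs.1,
      Function.update_apply]
    split_ifs with hvi
    · rfl
    · exact h v (by omega)
  rintro s₁ ⟨hf₁, h₁⟩
  refine Runs.seq (Q := fun s' => Frame [7] [3] s s' ∧ Sound G x₀ w (s'.arr 3) ∧
    ShortBound G x₀ w 0 (s'.arr 3)) (Runs.put ?_) ?_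
  · have hs₁ := hs.of_frame hf₁
    refine ⟨hf₁.setArr _ _, ?_, ?_⟩
    · intro v
      simp only [setArr_arr, if_pos, Expr.eval, hs₁.2.1, hf₁.2 2 (by decide), hw,
        Function.update_apply, Fin.val_inj]
      split_ifs with hv
      · subst hv
        have := hw1 v
        exact ⟨by omega, Or.inr ⟨.nil, by simp [weightSum]⟩⟩
      · rw [h₁ v v.2]
        exact ⟨le_rfl, Or.inl rfl⟩
    -- The only walk without edges is the trivial one, whose cost is the weight of the source.
    · intro v p hp
      cases p with
      | nil => simp [setArr_arr, Expr.eval, hs₁.2.1, hf₁.2 2 (by decide), hw, weightSum]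
      | cons h q => simp at hp
  rintro s₂ ⟨hf₂, hd₂, hb₂⟩
  refine (Runs.loop (n := n) (fun j s' => Frame [5, 6, 7, 8] [3] s s' ∧ Sound G x₀ w (s'.arr 3) ∧
    ShortBound G x₀ w j (s'.arr 3)) ?_ ?_ ?_).mono le_rfl ?_
  · exact fun i s' h => (h.1.1 0 (by decide)).trans hs.1
  · exact ⟨hf₂.mono.setReg _, hd₂, hb₂⟩
  · rintro j hj s' h5 ⟨hf, hd, hb⟩
    refine (runs_round (hs.of_frame hf) (w := w) (fun v => ?_) hd hb).mono le_rfl ?_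
    · rw [hf.2 2 (by decide), hw]
    · rintro s'' ⟨hf', hd', hb'⟩
      exact ⟨(hf'.1 5 (by decide)).trans h5, (hf.trans hf').setReg _, hd', hb'⟩
  · rintro s' ⟨hf, hd, hb⟩
    exact ⟨hf, IsDist.of_rounds hG hw1 hd hb⟩

end Program

/-! ### The complete program: marking blocks, counting colours, reading off the optimum -/

section Program

/-- If the distance of the vertex in register `7` is zero, mark it in array `4`, and also in array
`5` if it has the colour of the vertex in register `3`. -/
def markVertex : Prog :=
  .ifLt (.get 3 (.reg 7)) (.lit 1)
    (.seq (.put 4 (.reg 7) (.lit 1))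
      (.ifLt (.get 1 (.reg 7)) (.get 1 (.reg 3)) .skip
        (.ifLt (.get 1 (.reg 3)) (.get 1 (.reg 7)) .skip (.put 5 (.reg 7) (.lit 1))))) .skip

/-- Copy the row of the adjacency matrix that begins at the index in register `4`. -/
def copyRow : Prog :=
  .loop 7 (.seq (.put 2 (.reg 7) (.get 0 (.reg 4))) (.set 4 (.add (.reg 4) (.lit 1))))

/-- Mark the vertices of the block of the vertex in register `3` that contains the source. -/
def markBlock : Prog :=
  .seq copyRow (.seq (.put 2 (.reg 3) (.lit 1)) (.seq distances (.loop 7 markVertex)))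

/-- Count the colour of the vertex in register `7` unless it has been seen before. -/
def countColour : Prog :=
  .ifLt (.get 6 (.get 1 (.reg 7))) (.lit 1)
    (.seq (.put 6 (.get 1 (.reg 7)) (.lit 1)) (.set 9 (.add (.reg 9) (.lit 1)))) .skip

/-- Record the distance of the vertex in register `7` if it is unmarked. -/
def pickUnmarked : Prog :=
  .ifLt (.get 4 (.reg 7)) (.lit 1) (.set 10 (.get 3 (.reg 7))) .skip

/-- The program that computes the minimal number of moves. -/
def floodIt : Prog :=
  .seq (.loop 3 markBlock) (.seq (.loop 7 (.put 2 (.reg 7) (.get 5 (.reg 7))))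
    (.seq distances (.seq (.loop 7 countColour) (.seq (.loop 7 pickUnmarked)
      (.set 0 (.sub (.add (.reg 10) (.reg 9)) (.lit 1)))))))

/-- The running time of `markBlock`. -/
def markBlockTime (n : ℕ) : ℕ := loopTime n 9 + (4 + (distancesTime n + loopTime n 30))

/-- The running time of `floodIt`. -/
def floodItTime (n : ℕ) : ℕ :=
  loopTime n (markBlockTime n) + (loopTime n 5 + (distancesTime n +
    (loopTime n 20 + (loopTime n 10 + 6))))

variable {n k : ℕ} {G : SimpleGraph (Fin n)} {c : Fin n → Fin k} {x₀ : Fin n}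

/-- `f` is the indicator function of `A`. -/
def Flag {m : ℕ} (f : ℕ → ℕ) (A : Fin m → Prop) : Prop :=
  ∀ v : Fin m, (A v → f v = 1) ∧ (¬ A v → f v = 0)

theorem Flag.congr {m : ℕ} {f : ℕ → ℕ} {A B : Fin m → Prop} (h : Flag f A)
    (hAB : ∀ v, A v ↔ B v) : Flag f B := fun v => by rw [← hAB v]; exact h v

theorem Flag.update {m : ℕ} {f : ℕ → ℕ} {A B : Fin m → Prop} (h : Flag f A) (v : Fin m)
    (hB : ∀ a, B a ↔ A a ∨ a = v) : Flag (Function.update f v 1) B := by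
  intro a
  rw [hB a, Function.update_apply]
  by_cases ha : a = v
  · simp [ha]
  · simpa [ha, Fin.val_inj] using h a

theorem Flag.lt_one_iff {m : ℕ} {f : ℕ → ℕ} {A : Fin m → Prop} (h : Flag f A) (v : Fin m) :
    f v < 1 ↔ ¬ A v := by
  by_cases hv : A v
  · simp [hv, (h v).1 hv]
  · simp [hv, (h v).2 hv]

theorem runs_markVertex {s : State} {y v : Fin n} {A B : Fin n → Prop} (h3 : s.reg 3 = y)
    (h7 : s.reg 7 = v) (hc : ∀ v : Fin n, s.arr 1 v = c v)
    (hd : s.arr 3 v = 0 ↔ v ∈ block G y x₀) (hA : Flag (s.arr 4) A) (hB : Flag (s.arr 5) B) :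
    Runs markVertex 30 s fun s' => Frame [] [4, 5] s s' ∧
      Flag (s'.arr 4) (fun a => A a ∨ a = v ∧ a ∈ block G y x₀) ∧
      Flag (s'.arr 5) (fun a => B a ∨ a = v ∧ c y = c a ∧ a ∈ block G y x₀) := by
  refine Runs.ifLt (fun h1 => Runs.seq (T := 4) (T' := 22)
    (Q := fun s' => s' = s.setArr 4 v 1) (Runs.put ?_) ?_) fun h1 => Runs.skip ?_
  · simp only [Expr.eval, h7]
  · rintro s₁ rfl
    have hv : v ∈ block G y x₀ := by
      simp only [Expr.eval, h7] at h1
      exact hd.1 (by omega)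
    have hA' : Flag (Function.update (s.arr 4) v 1) (fun a => A a ∨ a = v ∧ a ∈ block G y x₀) :=
      hA.update v fun a => ⟨fun h => h.imp_right And.left, fun h => h.imp_right
        fun e => ⟨e, e ▸ hv⟩⟩
    have hne : c y ≠ c v → Flag (s.arr 5) (fun a => B a ∨ a = v ∧ c y = c a ∧ a ∈ block G y x₀) :=
      fun hcv => hB.congr fun a => ⟨Or.inl, fun h => h.resolve_right fun ⟨e, h', _⟩ =>
        hcv (e ▸ h')⟩
    have ev7 : (s.setArr 4 v 1).arr 1 v = c v := by simp [setArr_arr, hc]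
    have ev3 : (s.setArr 4 v 1).arr 1 y = c y := by simp [setArr_arr, hc]
    -- Equality of colours is the failure of both strict comparisons.
    refine Runs.ifLt (fun h2 => Runs.skip ?_) fun h2 => Runs.ifLt (fun h3' => Runs.skip ?_)
      fun h3' => Runs.put ?_
    · simp only [Expr.eval, setArr_reg, h7, h3, ev7, ev3] at h2
      exact ⟨(Frame.refl _ _ _).setArr _ _, hA', hne fun e => by rw [e] at h2; omega⟩
    · simp only [Expr.eval, setArr_reg, h7, h3, ev7, ev3] at h3'
      exact ⟨(Frame.refl _ _ _).setArr _ _, hA', hne fun e => by rw [e] at h3'; omega⟩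
    · simp only [Expr.eval, setArr_reg, h7, h3, ev7, ev3] at h2 h3' ⊢
      have he : c y = c v := Fin.ext (by omega)
      exact ⟨((Frame.refl _ _ _).setArr _ _).setArr _ _, hA', hB.update v fun a =>
        ⟨fun h => h.imp_right And.left, fun h => h.imp_right fun e => ⟨e, e ▸ he, e ▸ hv⟩⟩⟩
  · have hv : v ∉ block G y x₀ := by
      simp only [Expr.eval, h7] at h1
      exact fun h => h1 (by rw [hd.2 h]; exact Nat.one_pos)
    exact ⟨Frame.refl _ _ _, hA.congr fun a => ⟨Or.inl, fun h => h.resolve_right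
      fun ⟨e, h'⟩ => hv (e ▸ h')⟩, hB.congr fun a => ⟨Or.inl, fun h => h.resolve_right
      fun ⟨e, _, h'⟩ => hv (e ▸ h')⟩⟩

theorem runs_copyRow {s : State} {y : Fin n} (hs : Holds G x₀ s) (h4 : s.reg 4 = y * n) :
    Runs copyRow (loopTime n 9) s fun s' => Frame [4, 7] [2] s s' ∧ s'.reg 4 = (y + 1) * n ∧
      Flag (s'.arr 2) (fun v => G.Adj y v) := by
  refine (Runs.loop (n := n) (fun i s' => Frame [4, 7] [2] s s' ∧ s'.reg 4 = y * n + i ∧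
    ∀ v : Fin n, (v : ℕ) < i → (G.Adj y v → s'.arr 2 v = 1) ∧ (¬ G.Adj y v → s'.arr 2 v = 0))
    ?_ ?_ ?_).mono le_rfl ?_
  · exact fun i s' h => (h.1.1 0 (by decide)).trans hs.1
  · exact ⟨(Frame.refl _ _ _).setReg _, by simp [setReg_reg, h4], fun v hv => by omega⟩
  · rintro i hi s' h7 ⟨hf, h4', h⟩
    refine Runs.seq (T := 5) (T' := 4) (Q := fun s'' => s'' = s'.setArr 2 i (s'.arr 0 (y * n + i)))
      (Runs.put ?_) ?_
    · simp only [Expr.eval, h7, h4']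
    rintro s'' rfl
    refine Runs.set ⟨h7, ((hf.setArr _ _).setReg _).setReg _, ?_, fun v hv => ?_⟩
    · simp [setReg_reg, setArr_reg, Expr.eval, h4', Nat.add_assoc]
    · simp only [setReg_arr, setArr_arr, if_pos, Function.update_apply]
      split_ifs with hvi
      · rw [hf.2 0 (by decide), ← hvi]
        exact hs.2.2 y v
      · exact h v (by omega)
  · rintro s' ⟨hf, h4', h⟩
    exact ⟨hf, by rw [h4', Nat.succ_mul], fun v => h v v.2⟩

theorem runs_markBlock (hG : G.Connected) {s : State} {y : Fin n} {A B : Fin n → Prop}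
    (hs : Holds G x₀ s) (h3 : s.reg 3 = y) (h4 : s.reg 4 = y * n)
    (hc : ∀ v : Fin n, s.arr 1 v = c v) (hA : Flag (s.arr 4) A) (hB : Flag (s.arr 5) B) :
    Runs markBlock (markBlockTime n) s fun s' =>
      Frame [4, 5, 6, 7, 8] [2, 3, 4, 5] s s' ∧ s'.reg 4 = (y + 1) * n ∧
      Flag (s'.arr 4) (fun a => A a ∨ a ∈ block G y x₀) ∧
      Flag (s'.arr 5) (fun a => B a ∨ c y = c a ∧ a ∈ block G y x₀) := by
  classical
  refine Runs.seq (runs_copyRow hs h4) ?_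
  rintro s₁ ⟨hf₁, h4₁, hrow⟩
  refine Runs.seq (Q := fun s' => Frame [4, 7] [2] s s' ∧ s'.reg 4 = (y + 1) * n ∧
    Flag (s'.arr 2) (fun v => v ∈ closedNbhd G y)) (Runs.put ⟨hf₁.setArr _ _, h4₁, ?_⟩) ?_
  · simp only [setArr_arr, if_pos, Expr.eval, hf₁.1 3 (by decide), h3]
    exact hrow.update y fun a => or_comm
  rintro s₂ ⟨hf₂, h4₂, hcost⟩
  refine Runs.seq (runs_distances hG (hs.of_frame hf₂)
    (w := fun v => if v ∈ closedNbhd G y then 1 else 0) ?_ ?_) ?_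
  · intro v
    by_cases hv : v ∈ closedNbhd G y
    · simp [hv, (hcost v).1 hv]
    · simp [hv, (hcost v).2 hv]
  · intro v
    split_ifs <;> simp
  rintro s₃ ⟨hf₃, hdist⟩
  have hf₃' : Frame [4, 5, 6, 7, 8] [2, 3] s s₃ :=
    (hf₂.mono (rs' := [4, 5, 6, 7, 8]) (as' := [2, 3])).trans hf₃
  refine (Runs.loop (n := n) (fun i s' => Frame [7] [4, 5] s₃ s' ∧
    Flag (s'.arr 4) (fun a => A a ∨ (a : ℕ) < i ∧ a ∈ block G y x₀) ∧
    Flag (s'.arr 5) (fun a => B a ∨ (a : ℕ) < i ∧ c y = c a ∧ a ∈ block G y x₀))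
    ?_ ?_ ?_).mono le_rfl ?_
  · exact fun i s' h => (h.1.1 0 (by decide)).trans ((hf₃'.1 0 (by decide)).trans hs.1)
  · refine ⟨(Frame.refl _ _ _).setReg _, ?_, ?_⟩
    · rw [setReg_arr, hf₃'.2 4 (by decide)]
      exact hA.congr fun a => by simp
    · rw [setReg_arr, hf₃'.2 5 (by decide)]
      exact hB.congr fun a => by simp
  · rintro i hi s' h7 ⟨hf, hA', hB'⟩
    have hf' : Frame [4, 5, 6, 7, 8] [2, 3, 4, 5] s s' :=
      (hf₃'.mono (rs' := [4, 5, 6, 7, 8]) (as' := [2, 3, 4, 5])).trans hf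
    refine (runs_markVertex (G := G) (x₀ := x₀) (c := c) (y := y) (v := ⟨i, hi⟩)
      (by rw [hf'.1 3 (by decide), h3]) h7 (fun v => by rw [hf'.2 1 (by decide), hc]) ?_
      hA' hB').mono le_rfl ?_
    · rw [hf.2 3 (by decide)]
      exact hdist.eq_zero_iff ⟨i, hi⟩
    · rintro s'' ⟨hf'', hA'', hB''⟩
      have hlt : ∀ a : Fin n, (a : ℕ) < i + 1 ↔ (a : ℕ) < i ∨ a = ⟨i, hi⟩ := fun a => by
        rw [Nat.lt_succ_iff_lt_or_eq, Fin.ext_iff]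
      refine ⟨(hf''.1 7 (by decide)).trans h7, (hf.trans hf'').setReg _, hA''.congr fun a => ?_,
        hB''.congr fun a => ?_⟩
      · rw [hlt]; tauto
      · rw [hlt]; tauto
  · rintro s' ⟨hf, hA', hB'⟩
    refine ⟨(hf₃'.mono (rs' := [4, 5, 6, 7, 8]) (as' := [2, 3, 4, 5])).trans hf, ?_,
      hA'.congr fun a => by simp, hB'.congr fun a => by simp⟩
    rw [hf.1 4 (by decide), hf₃.1 4 (by decide), h4₂]

/-- The marks are the unions of the blocks over all `y`, which are the complements of the terminal
vertices and, with `y` restricted to the colour of the vertex, of the block maxima. -/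
theorem runs_markBlocks (hG : G.Connected) {s : State} (hs : Holds G x₀ s) (h4 : s.reg 4 = 0)
    (hc : ∀ v : Fin n, s.arr 1 v = c v) (hA : ∀ v, s.arr 4 v = 0) (hB : ∀ v, s.arr 5 v = 0) :
    Runs (.loop 3 markBlock) (loopTime n (markBlockTime n)) s fun s' =>
      Frame [3, 4, 5, 6, 7, 8] [2, 3, 4, 5] s s' ∧
      Flag (s'.arr 4) (fun a => ¬ Terminal G x₀ a) ∧
      Flag (s'.arr 5) (fun a => ¬ BlockMax G x₀ c a) := by
  refine (Runs.loop (n := n) (fun i s' => Frame [3, 4, 5, 6, 7, 8] [2, 3, 4, 5] s s' ∧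
    s'.reg 4 = i * n ∧
    Flag (s'.arr 4) (fun a => ∃ y : Fin n, (y : ℕ) < i ∧ a ∈ block G y x₀) ∧
    Flag (s'.arr 5) (fun a => ∃ y : Fin n, (y : ℕ) < i ∧ c y = c a ∧ a ∈ block G y x₀))
    ?_ ?_ ?_).mono le_rfl ?_
  · exact fun i s' h => (h.1.1 0 (by decide)).trans hs.1
  · refine ⟨(Frame.refl _ _ _).setReg _, by simp [setReg_reg, h4], ?_, ?_⟩
    · exact fun v => ⟨by simp, fun _ => hA v⟩
    · exact fun v => ⟨by simp, fun _ => hB v⟩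
  · rintro i hi s' h3 ⟨hf, h4', hA', hB'⟩
    refine (runs_markBlock hG (y := ⟨i, hi⟩) (hs.of_frame hf) h3 h4'
      (fun v => by rw [hf.2 1 (by decide), hc]) hA' hB').mono le_rfl ?_
    rintro s'' ⟨hf', h4'', hA'', hB''⟩
    have hlt : ∀ a : Fin n, (a : ℕ) < i + 1 ↔ (a : ℕ) < i ∨ a = ⟨i, hi⟩ := fun a => by
      rw [Nat.lt_succ_iff_lt_or_eq, Fin.ext_iff]
    refine ⟨(hf'.1 3 (by decide)).trans h3, (hf.trans hf').setReg _, h4'', hA''.congr fun a => ?_,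
      hB''.congr fun a => ?_⟩
    · simp only [hlt, or_and_right, exists_or, exists_eq_left]
    · simp only [hlt, or_and_right, exists_or, exists_eq_left]
  · rintro s' ⟨hf, -, hA', hB'⟩
    exact ⟨hf, hA'.congr fun a => by simp [Terminal], hB'.congr fun a => by simp [BlockMax]⟩

open Classical in
-- The loop runs over vertices, not colours, so the time does not depend on `k`, which may be much
-- larger than `n`.
theorem runs_countColours {s : State} (h0 : s.reg 0 = n) (hc : ∀ v : Fin n, s.arr 1 v = c v)
    (h9 : s.reg 9 = 0) (h6 : ∀ i, s.arr 6 i = 0) :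
    Runs (.loop 7 countColour) (loopTime n 20) s fun s' => Frame [7, 9] [6] s s' ∧
      s'.reg 9 = (Set.range c).ncard := by
  refine (Runs.loop (n := n) (fun i s' => Frame [7, 9] [6] s s' ∧
    s'.reg 9 = ((Finset.univ.filter fun v : Fin n => (v : ℕ) < i).image c).card ∧
    Flag (s'.arr 6) (fun j : Fin k => ∃ v : Fin n, (v : ℕ) < i ∧ c v = j)) ?_ ?_ ?_).mono le_rfl ?_
  · exact fun i s' h => (h.1.1 0 (by decide)).trans h0
  · exact ⟨(Frame.refl _ _ _).setReg _, by simp [setReg_reg, h9], fun v => ⟨by simp, fun _ => h6 v⟩⟩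
  · rintro i hi s' h7 ⟨hf, h9', hF⟩
    have hlt : ∀ a : Fin n, (a : ℕ) < i + 1 ↔ a = ⟨i, hi⟩ ∨ (a : ℕ) < i := fun a => by
      rw [Nat.lt_succ_iff_lt_or_eq, Fin.ext_iff, or_comm]
    have hfilter : (Finset.univ.filter fun v : Fin n => (v : ℕ) < i + 1) =
        insert ⟨i, hi⟩ (Finset.univ.filter fun v : Fin n => (v : ℕ) < i) := by
      ext a
      simp [hlt]
    have hmem : c ⟨i, hi⟩ ∈ (Finset.univ.filter fun v : Fin n => (v : ℕ) < i).image c ↔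
        ∃ v : Fin n, (v : ℕ) < i ∧ c v = c ⟨i, hi⟩ := by simp
    have hev : s'.arr 1 i = c ⟨i, hi⟩ := by rw [hf.2 1 (by decide)]; exact hc ⟨i, hi⟩
    have hiff := hF.lt_one_iff (c ⟨i, hi⟩)
    rw [hfilter, Finset.image_insert]
    refine Runs.ifLt (fun h => Runs.seq (T := 5) (T' := 10)
      (Q := fun s'' => s'' = s'.setArr 6 (c ⟨i, hi⟩) 1) (Runs.put ?_) ?_) fun h => Runs.skip ?_
    · simp only [Expr.eval, h7, hev]
    · rintro s'' rfl
      simp only [Expr.eval, h7, hev] at h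
      rw [hiff, ← hmem] at h
      refine Runs.set ⟨h7, ((hf.setArr _ _).setReg _).setReg _, ?_, ?_⟩
      · simp [setReg_reg, setArr_reg, Expr.eval, h9', Finset.card_insert_of_notMem h]
      · simp only [setReg_arr, setArr_arr, if_pos]
        refine hF.update _ fun j => ?_
        simp only [hlt, or_and_right, exists_or, exists_eq_left]
        rw [or_comm, @eq_comm _ j]
    · simp only [Expr.eval, h7, hev] at h
      rw [hiff, not_not, ← hmem] at h
      refine ⟨h7, hf.setReg _, ?_, hF.congr fun j => ?_⟩
      · rw [Finset.insert_eq_of_mem h]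
        simpa [setReg_reg] using h9'
      · simp only [hlt, or_and_right, exists_or, exists_eq_left]
        refine ⟨Or.inr, fun h' => h'.elim (fun e => ?_) id⟩
        rw [← e]
        exact hmem.1 h
  · rintro s' ⟨hf, h9', -⟩
    refine ⟨hf, ?_⟩
    rw [h9', ← Set.image_univ, Set.ncard_eq_toFinset_card']
    congr 1
    ext j
    simp

theorem runs_pickUnmarked {s : State} (h0 : s.reg 0 = n)
    (hA : Flag (s.arr 4) (fun a => ¬ Terminal G x₀ a)) (hex : ∃ v, Terminal G x₀ v) :
    Runs (.loop 7 pickUnmarked) (loopTime n 10) s fun s' => Frame [7, 10] [] s s' ∧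
      ∃ v : Fin n, Terminal G x₀ v ∧ s'.reg 10 = s.arr 3 v := by
  refine (Runs.loop (n := n) (fun i s' => Frame [7, 10] [] s s' ∧
    ((∃ v : Fin n, (v : ℕ) < i ∧ Terminal G x₀ v) →
      ∃ v : Fin n, Terminal G x₀ v ∧ s'.reg 10 = s.arr 3 v)) ?_ ?_ ?_).mono le_rfl ?_
  · exact fun i s' h => (h.1.1 0 (by decide)).trans h0
  · exact ⟨(Frame.refl _ _ _).setReg _, by simp⟩
  · rintro i hi s' h7 ⟨hf, h⟩
    have hiff := hA.lt_one_iff ⟨i, hi⟩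
    refine Runs.ifLt (fun h1 => Runs.set ?_) fun h1 => Runs.skip ?_
    · simp only [Expr.eval, h7, hf.2 4 (by decide)] at h1
      refine ⟨h7, (hf.setReg _).setReg _, fun _ => ⟨⟨i, hi⟩, not_not.1 (hiff.1 h1), ?_⟩⟩
      simp [setReg_reg, Expr.eval, h7, hf.2 3 (by decide)]
    · simp only [Expr.eval, h7, hf.2 4 (by decide)] at h1
      refine ⟨h7, hf.setReg _, fun ⟨v, hv, ht⟩ => ?_⟩
      have hvi : (v : ℕ) < i := by
        rcases Nat.lt_succ_iff_lt_or_eq.1 hv with h' | rfl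
        · exact h'
        · exact absurd (hiff.2 (not_not.2 ht)) h1
      obtain ⟨u, hu, hu'⟩ := h ⟨v, hvi, ht⟩
      exact ⟨u, hu, by simpa [setReg_reg] using hu'⟩
  · rintro s' ⟨hf, h⟩
    obtain ⟨v, hv⟩ := hex
    exact ⟨hf, h ⟨v, v.2, hv⟩⟩

/-- Neither `Ω` nor the class maxima are computed: by `isOptimum_of_walkCost`, the distance to any
one terminal vertex, with weight 0 on the block maxima only, already gives the optimum. -/
theorem runs_floodIt (hG : G.Connected) (hAT : ATFree G) (hx₀ : IsExtreme G x₀)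
    (hc : ∀ u v, G.Adj u v → c u ≠ c v) {s : State} (hs : Holds G x₀ s)
    (hcol : ∀ v : Fin n, s.arr 1 v = c v) (h4 : s.reg 4 = 0) (h9 : s.reg 9 = 0)
    (ha4 : ∀ v, s.arr 4 v = 0) (ha5 : ∀ v, s.arr 5 v = 0) (ha6 : ∀ v, s.arr 6 v = 0) :
    Runs floodIt (floodItTime n) s fun s' => IsOptimum G x₀ c (s'.reg 0) := by
  classical
  refine Runs.seq (runs_markBlocks hG hs h4 hcol ha4 ha5) ?_
  rintro s₁ ⟨hf₁, hA, hB⟩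
  refine Runs.seq (Q := fun s' => Frame [7] [2] s₁ s' ∧
    Flag (s'.arr 2) (fun a => ¬ BlockMax G x₀ c a))
    ((Runs.loop (n := n) (fun i s' => Frame [7] [2] s₁ s' ∧
      ∀ v < i, s'.arr 2 v = s₁.arr 5 v) ?_ ?_ ?_).mono le_rfl ?_) ?_
  · exact fun i s' h => (h.1.1 0 (by decide)).trans ((hf₁.1 0 (by decide)).trans hs.1)
  · exact ⟨(Frame.refl _ _ _).setReg _, fun v hv => absurd hv (Nat.not_lt_zero v)⟩
  · rintro i hi s' h7 ⟨hf, h⟩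
    refine Runs.put ⟨h7, (hf.setArr _ _).setReg _, fun v hv => ?_⟩
    simp only [setReg_arr, setArr_arr, if_pos, Expr.eval, h7, hf.2 5 (by decide),
      Function.update_apply]
    split_ifs with hvi
    · rw [hvi]
    · exact h v (by omega)
  · rintro s' ⟨hf, h⟩
    exact ⟨hf, fun v => by rw [h v v.2]; exact hB v⟩
  rintro s₂ ⟨hf₂, hcost⟩
  have hf₂' := hf₁.trans hf₂
  refine Runs.seq (runs_distances hG (hs.of_frame hf₂')
    (w := fun v => if BlockMax G x₀ c v then 0 else 1) ?_ ?_) ?_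
  · intro v
    by_cases hv : BlockMax G x₀ c v
    · simp [hv, (hcost v).2 (not_not.2 hv)]
    · simp [hv, (hcost v).1 hv]
  · intro v
    split_ifs <;> simp
  rintro s₃ ⟨hf₃, hdist⟩
  have hf₃' := hf₂'.trans hf₃
  refine Runs.seq (runs_countColours (c := c) ((hf₃'.1 0 (by decide)).trans hs.1)
    (fun v => by rw [hf₃'.2 1 (by decide), hcol]) ((hf₃'.1 9 (by decide)).trans h9)
    (fun v => by rw [hf₃'.2 6 (by decide), ha6])) ?_
  rintro s₄ ⟨hf₄, hcount⟩
  refine Runs.seq (runs_pickUnmarked (G := G) (x₀ := x₀) (s := s₄)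
    ((hf₄.1 0 (by decide)).trans ((hf₃'.1 0 (by decide)).trans hs.1)) ?_
    (exists_terminal hAT hx₀)) ?_
  · rw [hf₄.2 4 (by decide), hf₃.2 4 (by decide), hf₂.2 4 (by decide)]
    exact hA
  rintro s₅ ⟨hf₅, v, hv, h10⟩
  refine Runs.set ?_
  simp only [setReg_reg, if_pos, Expr.eval, h10, hf₅.1 9 (by decide), hcount,
    hf₄.2 3 (by decide)]
  exact isOptimum_of_walkCost hG hAT hx₀ hc hv (hdist v).1 (hdist v).2

theorem holds_input (G : SimpleGraph (Fin n)) (c : Fin n → Fin k) (x₀ : Fin n) :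
    Holds G x₀ (input G c x₀) := by
  refine ⟨rfl, rfl, fun u v => ?_⟩
  have key : (∃ a b : Fin n, G.Adj a b ∧ (u : ℕ) * n + v = (a : ℕ) * n + b) ↔ G.Adj u v := by
    refine ⟨?_, fun h => ⟨u, v, h, rfl⟩⟩
    rintro ⟨a, b, hab, h⟩
    have hn : 0 < n := u.pos
    -- Quotient and remainder modulo `n` recover the row and the column from the matrix index.
    have h1 := congrArg (· / n) h
    have h2 := congrArg (· % n) h
    simp only [Nat.mul_add_mod_self_right, Nat.mod_eq_of_lt v.2, Nat.mod_eq_of_lt b.2] at h2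
    simp only [Nat.mul_comm _ n, Nat.mul_add_div hn, Nat.div_eq_of_lt v.2, Nat.div_eq_of_lt b.2,
      Nat.add_zero] at h1
    rwa [Fin.ext h1, Fin.ext h2]
  constructor
  · intro h
    exact if_pos (key.2 h)
  · intro h
    exact if_neg fun h' => h (key.1 h')

theorem exists_polynomial_floodItTime : ∃ p : Polynomial ℕ, ∀ n, p.eval n = floodItTime n := by
  have loop : ∀ f : ℕ → ℕ, (∃ p : Polynomial ℕ, ∀ n, p.eval n = f n) →
      ∃ p : Polynomial ℕ, ∀ n, p.eval n = loopTime n (f n) := by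
    rintro f ⟨p, hp⟩
    exact ⟨.X * (p + 7) + 5, fun n => by simp [loopTime, hp]⟩
  have add : ∀ f g : ℕ → ℕ, (∃ p : Polynomial ℕ, ∀ n, p.eval n = f n) →
      (∃ p : Polynomial ℕ, ∀ n, p.eval n = g n) →
      ∃ p : Polynomial ℕ, ∀ n, p.eval n = f n + g n := by
    rintro f g ⟨p, hp⟩ ⟨q, hq⟩
    exact ⟨p + q, fun n => by simp [hp, hq]⟩
  have const : ∀ a : ℕ, ∃ p : Polynomial ℕ, ∀ n, p.eval n = a := fun a => ⟨.C a, by simp⟩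
  have hd : ∃ p : Polynomial ℕ, ∀ n, p.eval n = distancesTime n :=
    add _ _ (loop _ (const 5)) (add _ _ (const 4) (loop _ (add _ _ (const 2)
      (loop _ (loop _ (const 30))))))
  have hm : ∃ p : Polynomial ℕ, ∀ n, p.eval n = markBlockTime n :=
    add _ _ (loop _ (const 9)) (add _ _ (const 4) (add _ _ hd (loop _ (const 30))))
  exact add _ _ (loop _ hm) (add _ _ (loop _ (const 5)) (add _ _ hd
    (add _ _ (loop _ (const 20)) (add _ _ (loop _ (const 10)) (const 6)))))

end Program

end FloodIt

theorem mainTheorem2 :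
    -- one program computes the minimal number of moves in polynomial time
    (∃ (P : FloodIt.Prog) (p : Polynomial ℕ),
      ∀ (n k : ℕ) (G : SimpleGraph (Fin n)) (c : Fin n → Fin k) (x₀ : Fin n),
        G.Connected → FloodIt.ATFree G → (∀ u v, G.Adj u v → c u ≠ c v) →
        FloodIt.IsExtreme G x₀ →
        ∃ (t : ℕ) (s : FloodIt.State),
          FloodIt.Exec P (FloodIt.input G c x₀) t s ∧ t ≤ p.eval n ∧
          FloodIt.IsOptimum G x₀ c (s.reg 0)) ∧
    -- the formula for the minimal number of moves
    (∀ (V C : Type*) [Fintype V] (G : SimpleGraph V) (c : V → C) (x₀ x : V),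
        G.Connected → FloodIt.ATFree G → (∀ u v, G.Adj u v → c u ≠ c v) →
        FloodIt.IsExtreme G x₀ → FloodIt.IsFarthest G x₀ x →
        ∃ m w : ℕ, FloodIt.IsOptimum G x₀ c m ∧
          FloodIt.IsCheapest G x₀ c (FloodIt.farMaxima G x₀ c x) w ∧
          m + 1 = w + (Set.range c).ncard) := by
  refine ⟨?_, fun V C _ G c x₀ x hG hAT hc hx₀ hx =>
    FloodIt.exists_optimum_cheapest hG hAT hx₀ hc hx⟩
  obtain ⟨p, hp⟩ := FloodIt.exists_polynomial_floodItTime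
  refine ⟨FloodIt.floodIt, p, fun n k G c x₀ hG hAT hc hx₀ => ?_⟩
  rw [hp]
  exact FloodIt.runs_floodIt hG hAT hx₀ hc (FloodIt.holds_input G c x₀)
    (fun v => by simp [FloodIt.input]) rfl rfl (fun _ => rfl) (fun _ => rfl) (fun _ => rfl)
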